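/- Let $(Z,d)$ be a metric space with a Borel measure $\nu$ that is doubling: there is a constant $C$ with $0<\nu(B(z,2r))\le C\,\nu(B(z,r))<\infty$ for all $z\in Z$, $r>0$. Fix $R>0$, $\tau\ge 1$. For $\theta\in[0,1]$ let $B^\theta_{1,1}(Z)$ be the set of measurable $u:Z\to\mathbb R$ with $$\|u\|_{L^1(Z)}+\int_0^R\int_Z \frac{1}{\nu(B(x,t))}\int_{B(x,t)}|u(y)-u(x)|\,d\nu(y)\,d\nu(x)\,\frac{dt}{t^{1+\theta}}<\infty ,$$ and let $A^\theta_{1,\tau}(Z)$ be the set of measurable $u:Z\to\mathbb R$ with $$\|u\|_{L^1(Z)}+\sup_{\mathcal B}\sum_{B\in\mathcal B}\frac{1}{\operatorname{rad}(B)^\theta}\int_{\tau B}|u-u_{\tau B}|\,d\nu<\infty ,$$ where the supremum is over all collections $\mathcal B$ of balls of radius at most $R/\tau$ such that the balls $\tau B$, $B\in\mathcal B$, are pairwise disjoint, and $u_{\tau B}$ is the mean of $u$ over $\tau B$. Let $BV(Z)$ be the set of $u\in L^1(Z)$ with $$\|Du\|(Z)=\inf\Big\{\liminf_{i\to\infty}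 I(u_i)\;:\; u_i \text{ locally Lipschitz},\ u_i\to u \text{ in } L^1(Z)\Big\}<\infty ,$$ where $I(v)$ is the infimum of $\int_Z g\,d\nu$ over all upper gradients $g$ of $v$, i.e. Borel functions $g:Z\to[0,\infty]$ with $|v(\gamma(b))-v(\gamma(a))|\le\int_\gamma g\,ds$ for all rectifiable curves $\gamma:[a,b]\to Z$. Then, for all $R>0$, $\tau\ge1$ and $\theta\in(0,1]$: 1. $L^1(Z)=A^0_{1,\tau}(Z)\supseteq B^0_{1,1}(Z)\supseteq A^\theta_{1,\tau}(Z)\supseteq A^1_{1,\tau}(Z)\subseteq BV(Z)$. 2. If $Z$ is bounded, every Lipschitz function $Z\to\mathbb R$ belongs to $B^0_{1,1}(Z)$. 3. All these inclusions except the last one are strict in general: there is a bounded metric space $Z$ with a doubling measure such that, for all $R>0$, $\tau\ge1$ and $\theta\in(0,1]$, $A^0_{1,\tau}(Z)\supsetneq B^0_{1,1}(Z)\supsetneq A^\theta_{1,\tau}(Z)$ and, if $\theta<1$, $A^\theta_{1,\tau}(Z)\supsetneq A^1_{1,\tau}(Z)$. -/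

import Mathlib

open MeasureTheory Filter Topology Set Metric
open scoped ENNReal NNReal

noncomputable section

/-- A doubling measure on a metric space: there is a constant `C` with
`0 < ν(B(z,2r)) ≤ C ν(B(z,r)) < ∞` for all `z` and all `r > 0` (open balls). -/
def IsDoubling {Z : Type*} [MetricSpace Z] [MeasurableSpace Z] (ν : Measure Z) : Prop :=
  ∃ C : ℝ≥0, ∀ (z : Z) (r : ℝ), 0 < r →
    0 < ν (ball z (2 * r)) ∧ ν (ball z (2 * r)) ≤ C * ν (ball z r) ∧ ν (ball z r) < ∞

/-- The class `L¹(Z)`, as a set of functions `Z → ℝ`. -/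
def L1Space {Z : Type*} [MeasurableSpace Z] (ν : Measure Z) : Set (Z → ℝ) :=
  {u | MemLp u 1 ν}

/-- The Besov energy
`∫₀^R ∫_Z ⨍_{B(x,t)} |u(y) - u(x)| dν(y) dν(x) t^{-(1+θ)} dt`, with values in `[0,∞]`. -/
def besovEnergy {Z : Type*} [MetricSpace Z] [MeasurableSpace Z] (ν : Measure Z)
    (R θ : ℝ) (u : Z → ℝ) : ℝ≥0∞ :=
  ∫⁻ t in Ioo (0 : ℝ) R,
    (∫⁻ x, (⨍⁻ y in ball x t, ‖u y - u x‖ₑ ∂ν) ∂ν) / ENNReal.ofReal (t ^ (1 + θ))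

/-- The norm of `B^θ_{1,1}(Z)`. -/
def besovNorm {Z : Type*} [MetricSpace Z] [MeasurableSpace Z] (ν : Measure Z)
    (R θ : ℝ) (u : Z → ℝ) : ℝ≥0∞ :=
  eLpNorm u 1 ν + besovEnergy ν R θ u

/-- The Besov space `B^θ_{1,1}(Z)` (computed with the scale bound `R`). -/
def BesovSpace {Z : Type*} [MetricSpace Z] [MeasurableSpace Z] (ν : Measure Z)
    (R θ : ℝ) : Set (Z → ℝ) :=
  {u | AEStronglyMeasurable u ν ∧ besovNorm ν R θ u < ∞}

/-- Collections of balls admissible for the John–Nirenberg norm. A ball `B` is given by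
its centre `B.1` and its radius `B.2`; all radii lie in `(0, R/τ]` and the inflated balls `τB`
of distinct members are disjoint. -/
def IsAdmissibleFamily {Z : Type*} [MetricSpace Z] (R τ : ℝ) (𝓑 : Set (Z × ℝ)) : Prop :=
  (∀ B ∈ 𝓑, 0 < B.2 ∧ B.2 ≤ R / τ) ∧
    𝓑.Pairwise fun B B' => Disjoint (ball B.1 (τ * B.2)) (ball B'.1 (τ * B'.2))

/-- `∫_{B(z,r)} |u - u_{B(z,r)}| dν`. -/
def ballOscillation {Z : Type*} [MetricSpace Z] [MeasurableSpace Z] (ν : Measure Z)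
    (u : Z → ℝ) (z : Z) (r : ℝ) : ℝ≥0∞ :=
  ∫⁻ y in ball z r, ‖u y - ⨍ w in ball z r, u w ∂ν‖ₑ ∂ν

/-- The supremum over admissible collections of
`∑_B rad(B)^{-θ} ∫_{τB} |u - u_{τB}| dν`. -/
def johnNirenbergEnergy {Z : Type*} [MetricSpace Z] [MeasurableSpace Z] (ν : Measure Z)
    (R τ θ : ℝ) (u : Z → ℝ) : ℝ≥0∞ :=
  ⨆ (𝓑 : Set (Z × ℝ)) (_ : IsAdmissibleFamily R τ 𝓑),
    ∑' B : 𝓑, ballOscillation ν u B.1.1 (τ * B.1.2) / ENNReal.ofReal (B.1.2 ^ θ)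

/-- The norm of `A^θ_{1,τ}(Z)`. -/
def johnNirenbergNorm {Z : Type*} [MetricSpace Z] [MeasurableSpace Z] (ν : Measure Z)
    (R τ θ : ℝ) (u : Z → ℝ) : ℝ≥0∞ :=
  eLpNorm u 1 ν + johnNirenbergEnergy ν R τ θ u

/-- The fractional John–Nirenberg space `A^θ_{1,τ}(Z)` (computed with the scale bound `R`). -/
def JohnNirenbergSpace {Z : Type*} [MetricSpace Z] [MeasurableSpace Z] (ν : Measure Z)
    (R τ θ : ℝ) : Set (Z → ℝ) :=
  {u | AEStronglyMeasurable u ν ∧ johnNirenbergNorm ν R τ θ u < ∞}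

/-- The line integral `∫_γ g ds` over a rectifiable curve `γ : [a,b] → Z`: the integral of `g`
along the arc-length parametrization of `γ` over `[0, length γ]`. -/
def lineIntegral {Z : Type*} [MetricSpace Z] (g : Z → ℝ≥0∞) (γ : ℝ → Z) (a b : ℝ) : ℝ≥0∞ :=
  ∫⁻ s in Icc 0 (variationOnFromTo γ (Icc a b) a b),
    g (naturalParameterization γ (Icc a b) a s)

/-- `g` is an upper gradient of the (finite-valued) function `u`: `g` is Borel and
`|u(γ b) - u(γ a)| ≤ ∫_γ g ds` for every rectifiable curve `γ : [a,b] → Z`. -/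
def IsUpperGradient {Z : Type*} [MetricSpace Z] [MeasurableSpace Z]
    (g : Z → ℝ≥0∞) (u : Z → ℝ) : Prop :=
  Measurable g ∧ ∀ (a b : ℝ) (γ : ℝ → Z), a ≤ b → ContinuousOn γ (Icc a b) →
    BoundedVariationOn γ (Icc a b) → ‖u (γ b) - u (γ a)‖ₑ ≤ lineIntegral g γ a b

/-- `I(u : Z)`: the infimum of `∫_Z g dν` over all upper gradients `g` of `u`. -/
def upperGradientEnergy {Z : Type*} [MetricSpace Z] [MeasurableSpace Z] (ν : Measure Z)
    (u : Z → ℝ) : ℝ≥0∞ :=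
  ⨅ (g : Z → ℝ≥0∞) (_ : IsUpperGradient g u), ∫⁻ x, g x ∂ν

/-- The total variation `‖Du‖(Z)`: the infimum of `liminf I(uᵢ : Z)` over all sequences of
locally Lipschitz functions converging to `u` in `L¹(Z)`. -/
def totalVariation {Z : Type*} [MetricSpace Z] [MeasurableSpace Z] (ν : Measure Z)
    (u : Z → ℝ) : ℝ≥0∞ :=
  ⨅ (v : ℕ → Z → ℝ) (_ : ∀ i, LocallyLipschitz (v i))
    (_ : Tendsto (fun i => eLpNorm (v i - u) 1 ν) atTop (𝓝 0)),
    liminf (fun i => upperGradientEnergy ν (v i)) atTop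

/-- The space `BV(Z)`. -/
def BVSpace {Z : Type*} [MetricSpace Z] [MeasurableSpace Z] (ν : Measure Z) : Set (Z → ℝ) :=
  {u | MemLp u 1 ν ∧ totalVariation ν u < ∞}

end

/-! Everything is read off the mean oscillation at scale `t`, `scaleOscillation`: the Besov energy
with exponent 0 is its integral against `dt/t`. Around a `t`-separated net, the balls of radius `t`
cover the space, and those of radius `2t` overlap boundedly by doubling. A colouring splits the
latter into boundedly many disjoint families, each admissible for the John–Nirenberg energy `J` of
exponent `θ` when `2t ≤ R`. Hence the oscillation at scale `t` is at most a constant times `t^θ J`,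
and always at most a constant times the `L¹` norm. As `t^(θ-1)` is integrable at 0 for `θ > 0`,
finite `J` forces finite Besov energy. The inflation `τ` only affects constants.

For `BV`, average `u` against tents of radius `ε`. Near a net point `z` the average is Lipschitz
with constant comparable to the oscillation over `ball z (2ε)` divided by `ε ν(ball z (2ε))`.
Summing these constants over the net balls gives an upper gradient whose integral is at most a
constant times `ε⁻¹` times the sum of the oscillations. For exponent 1 that sum is `O(ε)`, so the
energies stay bounded, while the `L¹` error, controlled by the oscillation at scale `ε`, tends to 0.

Strictness is seen on binary sequences with the fair coin measure, for series `u = ∑ b k r_{n k}` of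
Rademacher functions. Flipping bit `n k` preserves the measure and every ball of radius above `2^(-n
k)`, and changes `u` by exactly `2 b k`; so the mean oscillation of `u` on such a ball is at least
`b k`. With `b k = 2^(-k)`, `n k = 4^k` the Besov energy diverges. With `b k = 2^(-αk)`, `n k = k`
the series is `α`-Hölder, hence has finite energy of exponent `α`, but infinite energy of every
larger exponent. See `DoublingWith.tsum_net_le`, `DoublingWith.scaleOscillation_le_tsum`,
`DoublingWith.abs_tentAverage_sub_le` and `BinarySequence.le_lintegral_rademacherSeries_sub`. -/

/-! ### Arc length and upper gradients -/

/-- The arc-length function of a continuous curve of bounded variation is continuous. -/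
theorem continuousOn_variationOnFromTo {E : Type*} [PseudoMetricSpace E] {f : ℝ → E} {a b : ℝ}
    (hab : a ≤ b) (hc : ContinuousOn f (Icc a b)) (hf : BoundedVariationOn f (Icc a b)) :
    ContinuousOn (variationOnFromTo f (Icc a b) a) (Icc a b) := by
  intro x hx
  have ha : a ∈ Icc a b := left_mem_Icc.2 hab
  have hl := variationOnFromTo.tendsto_left ha hx hf.locallyBoundedVariationOn
    ((hc x hx).mono inter_subset_left)
  have hr := variationOnFromTo.tendsto_right ha hx hf.locallyBoundedVariationOn
    ((hc x hx).mono inter_subset_left)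
  -- The one-sided limits of arc length differ from its value by the jumps of `f`, which vanish by
  -- continuity.
  simp only [dist_self, sub_zero, add_zero] at hl hr
  have : Icc a b = (Icc a b ∩ Iio x) ∪ (Icc a b ∩ Ioi x) ∪ {x} := by
    ext y; simp only [mem_union, mem_inter_iff, mem_Iio, mem_Ioi, mem_singleton_iff]
    constructor
    · intro hy; rcases lt_trichotomy y x with h | h | h <;> simp [hy, h]
    · rintro ((h | h) | rfl) <;> first | exact h.1 | exact hx
  unfold ContinuousWithinAt
  rw [show 𝓝[Icc a b] x = 𝓝[(Icc a b ∩ Iio x) ∪ (Icc a b ∩ Ioi x) ∪ {x}] x from by rw [← this],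
    nhdsWithin_union, nhdsWithin_union, nhdsWithin_singleton]
  exact (hl.sup hr).sup (tendsto_pure_nhds _ _)

section NaturalParameterization

variable {E : Type*} [MetricSpace E] {γ : ℝ → E} {a b : ℝ}

theorem image_variationOnFromTo_Icc (hab : a ≤ b) (hc : ContinuousOn γ (Icc a b))
    (hf : BoundedVariationOn γ (Icc a b)) :
    variationOnFromTo γ (Icc a b) a '' Icc a b = Icc 0 (variationOnFromTo γ (Icc a b) a b) := by
  have hm := variationOnFromTo.monotoneOn hf.locallyBoundedVariationOn (left_mem_Icc.2 hab)
  refine Subset.antisymm ?_ ?_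
  · rintro _ ⟨x, hx, rfl⟩
    exact ⟨variationOnFromTo.nonneg_of_le _ _ hx.1, hm hx (right_mem_Icc.2 hab) hx.2⟩
  · have := intermediate_value_Icc hab (continuousOn_variationOnFromTo hab hc hf)
    rwa [variationOnFromTo.self] at this

/-- A chord is at most the variation, and unit speed makes the variation equal to the length of the
parameter interval. -/
theorem lipschitzOnWith_naturalParameterization (hab : a ≤ b) (hc : ContinuousOn γ (Icc a b))
    (hf : BoundedVariationOn γ (Icc a b)) :
    LipschitzOnWith 1 (naturalParameterization γ (Icc a b) a)
      (Icc 0 (variationOnFromTo γ (Icc a b) a b)) := by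
  have hu := has_unit_speed_naturalParameterization γ hf.locallyBoundedVariationOn
    (left_mem_Icc.2 hab)
  rw [image_variationOnFromTo_Icc hab hc hf] at hu
  intro x hx y hy
  wlog hxy : x ≤ y generalizing x y
  · rw [edist_comm, edist_comm x]; exact this hy hx (le_of_not_ge hxy)
  have h1 := eVariationOn.edist_le (naturalParameterization γ (Icc a b) a)
    (s := Icc 0 (variationOnFromTo γ (Icc a b) a b) ∩ Icc x y) ⟨hx, le_rfl, hxy⟩ ⟨hy, hxy, le_rfl⟩
  rw [hu hx hy, NNReal.coe_one, one_mul] at h1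
  rwa [edist_dist x y, dist_comm, Real.dist_eq, abs_of_nonneg (sub_nonneg.2 hxy), ENNReal.coe_one,
    one_mul]

end NaturalParameterization

/-- A function that is `L i`-Lipschitz on the members `U i` of an open cover has every Borel function
dominating `L i` on each `U i` as an upper gradient. -/
theorem isUpperGradient_of_lipschitzOnWith {Z ι : Type*} [MetricSpace Z] [MeasurableSpace Z]
    {v : Z → ℝ} {g : Z → ℝ≥0∞} (hg : Measurable g) (U : ι → Set Z) (L : ι → ℝ≥0)
    (hU : ∀ i, IsOpen (U i)) (hcov : ∀ x, ∃ i, x ∈ U i) (hv : ∀ i, LipschitzOnWith (L i) v (U i))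
    (hL : ∀ i, ∀ x ∈ U i, (L i : ℝ≥0∞) ≤ g x) : IsUpperGradient g v := by
  refine ⟨hg, fun a b γ hab hc hf => ?_⟩
  have hlip := lipschitzOnWith_naturalParameterization hab hc hf
  have hends : ∀ c ∈ Icc a b,
      naturalParameterization γ (Icc a b) a (variationOnFromTo γ (Icc a b) a c) = γ c := fun c hcm =>
    edist_eq_zero.1 (edist_naturalParameterization_eq_zero hf.locallyBoundedVariationOn
      (left_mem_Icc.2 hab) hcm)
  have h0 := hends a (left_mem_Icc.2 hab)
  have h1 := hends b (right_mem_Icc.2 hab)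
  rw [variationOnFromTo.self] at h0
  have hV : 0 ≤ variationOnFromTo γ (Icc a b) a b := variationOnFromTo.nonneg_of_le _ _ hab
  unfold lineIntegral
  rw [← h0, ← h1]
  generalize variationOnFromTo γ (Icc a b) a b = V at *
  generalize naturalParameterization γ (Icc a b) a = η at *
  -- Compactness cuts `[0, V]` into finitely many pieces, each sent by `η` into a single `U i`. On
  -- that piece the increment of `v ∘ η` is at most `L i` times its length, and the increments
  -- telescope.
  obtain ⟨t, ht0, htm, ⟨m, hm⟩, hti⟩ := exists_monotone_Icc_subset_open_cover_Icc hV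
    (c := fun i => (fun s : Icc 0 V => η s) ⁻¹' U i)
    (fun i => (hU i).preimage (continuousOn_iff_continuous_domRestrict.1 hlip.continuousOn))
    (fun s _ => mem_iUnion.2 (hcov (η s)))
  have key : ∀ n, ‖v (η (t n)) - v (η 0)‖ₑ ≤ ∫⁻ s in Ioc 0 (t n : ℝ), g (η s) := by
    intro n
    induction n with
    | zero => simp [ht0]
    | succ n ih =>
      obtain ⟨i, hi⟩ := hti n
      have hle : (t n : ℝ) ≤ t (n + 1) := htm n.le_succ
      have hmem : ∀ s ∈ Icc (t n : ℝ) (t (n + 1)), η s ∈ U i := fun s hs =>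
        hi (a := ⟨s, (t n).2.1.trans hs.1, hs.2.trans (t (n + 1)).2.2⟩) ⟨hs.1, hs.2⟩
      have hstep : ‖v (η (t (n + 1))) - v (η (t n))‖ₑ ≤
          ∫⁻ s in Ioc (t n : ℝ) (t (n + 1)), g (η s) := by
        calc ‖v (η (t (n + 1))) - v (η (t n))‖ₑ
            = edist (v (η (t (n + 1)))) (v (η (t n))) := (edist_eq_enorm_sub _ _).symm
          _ ≤ L i * edist (η (t (n + 1))) (η (t n)) :=
              hv i (hmem _ (right_mem_Icc.2 hle)) (hmem _ (left_mem_Icc.2 hle))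
          _ ≤ L i * ENNReal.ofReal (t (n + 1) - t n) := by
              gcongr
              have := hlip (t (n + 1)).2 (t n).2
              rwa [ENNReal.coe_one, one_mul, edist_dist (t (n + 1) : ℝ), Real.dist_eq,
                abs_of_nonneg (sub_nonneg.2 hle)] at this
          _ = ∫⁻ _ in Ioc (t n : ℝ) (t (n + 1)), (L i : ℝ≥0∞) := by
              rw [setLIntegral_const, Real.volume_Ioc]
          _ ≤ _ := setLIntegral_mono' measurableSet_Ioc
              fun s hs => hL i _ (hmem s (Ioc_subset_Icc_self hs))
      have hsum : v (η (t (n + 1))) - v (η 0) =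
          (v (η (t n)) - v (η 0)) + (v (η (t (n + 1))) - v (η (t n))) := by ring
      rw [hsum, ← Ioc_union_Ioc_eq_Ioc (t n).2.1 hle,
        lintegral_union measurableSet_Ioc (Ioc_disjoint_Ioc_of_le le_rfl)]
      exact (enorm_add_le _ _).trans (add_le_add ih hstep)
  have := key m
  rw [hm m le_rfl] at this
  exact this.trans (lintegral_mono_set Ioc_subset_Icc_self)

/-! ### Doubling measures, nets and colourings -/

/-- The inequalities of a doubling measure with doubling constant `C`. -/
structure DoublingWith {Z : Type*} [MetricSpace Z] [MeasurableSpace Z] (ν : Measure Z)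
    (C : ℝ≥0) : Prop where
  pos : ∀ (z : Z) (r : ℝ), 0 < r → 0 < ν (ball z r)
  finite : ∀ (z : Z) (r : ℝ), ν (ball z r) < ∞
  double : ∀ (z : Z) (r : ℝ), 0 < r → ν (ball z (2 * r)) ≤ C * ν (ball z r)

theorem IsDoubling.exists_doublingWith {Z : Type*} [MetricSpace Z] [MeasurableSpace Z]
    {ν : Measure Z} (h : IsDoubling ν) : ∃ C, DoublingWith ν C := by
  obtain ⟨C, hC⟩ := h
  refine ⟨C, fun z r hr => ?_, fun z r => ?_, fun z r hr => (hC z r hr).2.1⟩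
  · have := (hC z (r / 2) (by positivity)).1
    rwa [mul_div_cancel₀ _ two_ne_zero] at this
  · rcases le_or_gt r 0 with hr | hr
    · simp [ball_eq_empty.2 hr]
    · exact (hC z r hr).2.2

/-- A `t`-separated set whose `t`-balls cover the space. -/
structure IsNet {Z : Type*} [MetricSpace Z] (t : ℝ) (S : Set Z) : Prop where
  separated : S.Pairwise fun x y => t ≤ dist x y
  cover : ∀ x, ∃ z ∈ S, dist x z < t

/-- A maximal separated set works: an uncovered point could be added to it. -/
theorem exists_isNet {Z : Type*} [MetricSpace Z] {t : ℝ} (ht : 0 < t) :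
    ∃ S : Set Z, IsNet t S := by
  obtain ⟨S, hS⟩ := zorn_subset {S : Set Z | S.Pairwise fun x y => t ≤ dist x y} (by
    intro c hc hchain
    refine ⟨⋃₀ c, ?_, fun s hs => subset_sUnion_of_mem hs⟩
    exact (pairwise_sUnion hchain.directedOn).2 fun s hs => hc hs)
  refine ⟨S, hS.prop, fun x => ?_⟩
  by_contra! hx
  have hxS : x ∈ S := by
    refine hS.le_of_ge (y := insert x S) ?_ (subset_insert x S) (mem_insert x S)
    exact pairwise_insert.2 ⟨hS.prop, fun b hb _ => ⟨hx b hb, by rw [dist_comm]; exact hx b hb⟩⟩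
  have := hx x hxS
  rw [dist_self] at this
  linarith

/-- Greedy colouring of a finite graph with degrees at most `N`. -/
theorem exists_coloring_of_degree_le {ι : Type*} (r : ι → ι → Prop) (hr : ∀ i j, r i j → r j i)
    (N : ℕ) (s : Finset ι)
    (hs : ∀ i ∈ s, ∀ T ⊆ s, (∀ j ∈ T, r i j) → T.card ≤ N) :
    ∃ c : ι → Fin (N + 1), ∀ i ∈ s, ∀ j ∈ s, i ≠ j → r i j → c i ≠ c j := by
  classical
  induction s using Finset.induction_on with
  | empty => exact ⟨fun _ => 0, by simp⟩
  | insert a s ha ih =>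
    obtain ⟨c, hc⟩ := ih fun i hi T hT => hs i (Finset.mem_insert_of_mem hi) T
      (hT.trans (Finset.subset_insert a s))
    have hcard : ((s.filter (r a)).image c).card < Fintype.card (Fin (N + 1)) := by
      refine Finset.card_image_le.trans_lt ?_
      rw [Fintype.card_fin, Nat.lt_succ_iff]
      exact hs a (Finset.mem_insert_self a s) _
        ((Finset.filter_subset _ _).trans (Finset.subset_insert a s))
        fun j hj => (Finset.mem_filter.1 hj).2
    obtain ⟨k, hk⟩ : ∃ k, k ∉ (s.filter (r a)).image c := by
      by_contra! h
      rw [Finset.eq_univ_iff_forall.2 h, Finset.card_univ] at hcard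
      exact lt_irrefl _ hcard
    have hk' : ∀ j ∈ s, r a j → c j ≠ k := fun j hj hrj h =>
      hk (Finset.mem_image.2 ⟨j, Finset.mem_filter.2 ⟨hj, hrj⟩, h⟩)
    refine ⟨Function.update c a k, fun i hi j hj hij hrij => ?_⟩
    rcases Finset.mem_insert.1 hi with rfl | hi' <;> rcases Finset.mem_insert.1 hj with rfl | hj'
    · exact absurd rfl hij
    · rw [Function.update_self, Function.update_of_ne hij.symm]
      exact (hk' j hj' hrij).symm
    · rw [Function.update_self, Function.update_of_ne hij]
      exact hk' i hi' (hr _ _ hrij)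
    · rw [Function.update_of_ne (ne_of_mem_of_not_mem hi' ha),
        Function.update_of_ne (ne_of_mem_of_not_mem hj' ha)]
      exact hc i hi' j hj' hij hrij

namespace DoublingWith

variable {Z : Type*} [MetricSpace Z] [MeasurableSpace Z] {ν : Measure Z} {C : ℝ≥0}

theorem measure_ball_pow_le (h : DoublingWith ν C) (z : Z) {r : ℝ} (hr : 0 < r) (n : ℕ) :
    ν (ball z (2 ^ n * r)) ≤ C ^ n * ν (ball z r) := by
  induction n with
  | zero => simp
  | succ n ih =>
    calc ν (ball z (2 ^ (n + 1) * r)) = ν (ball z (2 * (2 ^ n * r))) := by ring_nf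
      _ ≤ C * ν (ball z (2 ^ n * r)) := h.double z _ (by positivity)
      _ ≤ C * (C ^ n * ν (ball z r)) := by gcongr
      _ = C ^ (n + 1) * ν (ball z r) := by ring

/-- Comparison of balls with different centres. -/
theorem measure_ball_le (h : DoublingWith ν C) {x y : Z} {r s : ℝ} (hs : 0 < s) (n : ℕ)
    (hd : r + dist x y ≤ 2 ^ n * s) : ν (ball x r) ≤ C ^ n * ν (ball y s) :=
  (measure_mono (ball_subset_ball' hd)).trans (h.measure_ball_pow_le y hs n)

theorem sigmaFinite (h : DoublingWith ν C) : SigmaFinite ν := by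
  rcases isEmpty_or_nonempty Z with hZ | ⟨⟨z⟩⟩
  · rw [Measure.eq_zero_of_isEmpty ν]; infer_instance
  · exact ⟨⟨⟨fun n => ball z n, fun _ => trivial, fun n => h.finite z n, iUnion_ball_nat z⟩⟩⟩

variable [BorelSpace Z]

theorem countable_of_separated (h : DoublingWith ν C) {t : ℝ} (ht : 0 < t) {S : Set Z}
    (hS : S.Pairwise fun x y => t ≤ dist x y) : S.Countable := by
  have := h.sigmaFinite
  have hd : Pairwise (Function.onFun Disjoint fun z : S => ball (z : Z) (t / 2)) := by
    intro x y hxy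
    refine ball_disjoint_ball ?_
    have := hS x.2 y.2 (fun e => hxy (Subtype.ext e))
    linarith
  have hc := Measure.countable_meas_pos_of_disjoint_iUnion (μ := ν)
    (fun z : S => measurableSet_ball (x := (z : Z)) (ε := t / 2)) hd
  rw [show {i : S | 0 < ν (ball (i : Z) (t / 2))} = univ from
    eq_univ_of_forall fun z => h.pos _ _ (by positivity), countable_univ_iff] at hc
  exact hc

/-- Volume packing: the disjoint balls `ball y (t/2)` lie in `ball z (8t)`. The exponent 5 comes
from `8t + 4t ≤ 2^5 · (t/2)`. -/
theorem card_le_of_separated (h : DoublingWith ν C) {t : ℝ} (ht : 0 < t) (z : Z) (T : Finset Z)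
    (hT : (T : Set Z).Pairwise fun x y => t ≤ dist x y) (hz : ∀ y ∈ T, dist y z < 4 * t) :
    (T.card : ℝ≥0∞) ≤ C ^ 5 := by
  have hpos := h.pos z (8 * t) (by positivity)
  have hfin := h.finite z (8 * t)
  rw [← ENNReal.mul_le_mul_iff_left hpos.ne' hfin.ne]
  calc (T.card : ℝ≥0∞) * ν (ball z (8 * t)) = ∑ y ∈ T, ν (ball z (8 * t)) := by simp
    _ ≤ ∑ y ∈ T, C ^ 5 * ν (ball y (t / 2)) := by
        refine Finset.sum_le_sum fun y hy => h.measure_ball_le (by positivity) 5 ?_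
        have := hz y hy
        rw [dist_comm] at this
        linarith
    _ = C ^ 5 * ν (⋃ y ∈ T, ball y (t / 2)) := by
        rw [measure_biUnion_finset _ fun _ _ => measurableSet_ball, Finset.mul_sum]
        intro x hx y hy hxy
        refine ball_disjoint_ball ?_
        have := hT hx hy hxy
        linarith
    _ ≤ C ^ 5 * ν (ball z (8 * t)) := by
        gcongr
        refine iUnion₂_subset fun y hy => ball_subset_ball' ?_
        have := hz y hy
        linarith

/-- A sum over a net is controlled by the sums over those subfamilies for which the balls of twice
the radius are disjoint. -/
theorem tsum_net_le (h : DoublingWith ν C) {t : ℝ} (ht : 0 < t) {S : Set Z}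
    (hS : S.Pairwise fun x y => t ≤ dist x y) (F : Z → ℝ≥0∞) (M : ℝ≥0∞)
    (hM : ∀ T : Finset Z,
      ((T : Set Z).Pairwise fun x y => Disjoint (ball x (2 * t)) (ball y (2 * t))) →
      ∑ z ∈ T, F z ≤ M) :
    ∑' z : S, F z ≤ (⌊C ^ 5⌋₊ + 1 : ℕ) * M := by
  classical
  rw [ENNReal.tsum_eq_iSup_sum]
  refine iSup_le fun s => ?_
  have hsS : ((s.map (Function.Embedding.subtype _) : Finset Z) : Set Z).Pairwise
      fun x y => t ≤ dist x y := hS.mono (by intro x; simp; tauto)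
  rw [show ∑ a ∈ s, F a = ∑ z ∈ s.map (Function.Embedding.subtype _), F z by simp]
  generalize s.map (Function.Embedding.subtype _) = s' at hsS
  -- Join two centres when their balls of radius `2t` meet. Neighbours are then less than `4t`
  -- apart, so packing bounds the degree, and each colour class is a disjoint family.
  obtain ⟨c, hc⟩ := exists_coloring_of_degree_le
    (fun x y : Z => ¬ Disjoint (ball x (2 * t)) (ball y (2 * t)))
    (fun x y hxy => by rwa [disjoint_comm]) ⌊C ^ 5⌋₊ s' (by
      intro z hz T hT hr
      refine Nat.le_floor ?_
      have := h.card_le_of_separated ht z T (hsS.mono hT) fun y hy => by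
        obtain ⟨w, hw⟩ := not_disjoint_iff.1 (hr y hy)
        have h1 := mem_ball.1 hw.1
        have h2 := mem_ball.1 hw.2
        have := dist_triangle_left y z w
        linarith
      exact_mod_cast this)
  calc ∑ z ∈ s', F z = ∑ k : Fin (⌊C ^ 5⌋₊ + 1), ∑ z ∈ s' with c z = k, F z :=
        (Finset.sum_fiberwise s' c F).symm
    _ ≤ ∑ _k : Fin (⌊C ^ 5⌋₊ + 1), M := by
        refine Finset.sum_le_sum fun k _ => hM _ fun x hx y hy hxy => ?_
        by_contra hd
        simp only [Finset.coe_filter, mem_ofPred_eq] at hx hy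
        exact hc x hx.1 y hy.1 hxy hd (hx.2.trans hy.2.symm)
    _ = _ := by simp

end DoublingWith

/-! ### Oscillations over balls and at a scale -/

/-- The mean oscillation `∫_Z ⨍_{B(x,t)} |u(y) - u(x)| dν(y) dν(x)` of `u` at scale `t`. -/
noncomputable def scaleOscillation {Z : Type*} [MetricSpace Z] [MeasurableSpace Z] (ν : Measure Z)
    (u : Z → ℝ) (t : ℝ) : ℝ≥0∞ :=
  ∫⁻ x, (⨍⁻ y in ball x t, ‖u y - u x‖ₑ ∂ν) ∂ν

section

variable {Z : Type*} [MetricSpace Z] [MeasurableSpace Z] {ν : Measure Z} {C : ℝ≥0}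

theorem ballOscillation_le_two_mul {u : Z → ℝ} (hu : AEStronglyMeasurable u ν) {z : Z} {r : ℝ}
    (hfin : ν (ball z r) < ∞) :
    ballOscillation ν u z r ≤ 2 * ∫⁻ y in ball z r, ‖u y‖ₑ ∂ν := by
  unfold ballOscillation
  have hc : ‖⨍ w in ball z r, u w ∂ν‖ₑ * ν (ball z r) ≤ ∫⁻ y in ball z r, ‖u y‖ₑ ∂ν := by
    rw [setAverage_eq, enorm_smul]
    calc ‖(ν.real (ball z r))⁻¹‖ₑ * ‖∫ w in ball z r, u w ∂ν‖ₑ * ν (ball z r)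
        ≤ ‖(ν.real (ball z r))⁻¹‖ₑ * (∫⁻ y in ball z r, ‖u y‖ₑ ∂ν) * ν (ball z r) := by
          gcongr; exact enorm_integral_le_lintegral_enorm _
      _ = (‖(ν.real (ball z r))⁻¹‖ₑ * ν (ball z r)) * ∫⁻ y in ball z r, ‖u y‖ₑ ∂ν := by ring
      _ ≤ 1 * ∫⁻ y in ball z r, ‖u y‖ₑ ∂ν := by
          gcongr
          rw [Real.enorm_of_nonneg (by positivity), ← ofReal_measureReal hfin.ne,
            ← ENNReal.ofReal_mul (by positivity)]
          exact ENNReal.ofReal_le_one.2 (inv_mul_le_one)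
      _ = _ := one_mul _
  calc ∫⁻ y in ball z r, ‖u y - ⨍ w in ball z r, u w ∂ν‖ₑ ∂ν
      ≤ ∫⁻ y in ball z r, (‖u y‖ₑ + ‖⨍ w in ball z r, u w ∂ν‖ₑ) ∂ν :=
        lintegral_mono fun y => enorm_sub_le
    _ = (∫⁻ y in ball z r, ‖u y‖ₑ ∂ν) + ‖⨍ w in ball z r, u w ∂ν‖ₑ * ν (ball z r) := by
        rw [lintegral_add_left' hu.enorm.restrict, setLIntegral_const]
    _ ≤ _ := by rw [two_mul]; gcongr

variable [BorelSpace Z] in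
theorem sum_ballOscillation_le {ι : Type*} {u : Z → ℝ} (hu : AEStronglyMeasurable u ν)
    (hfin : ∀ z r, ν (ball z r) < ∞) (T : Finset ι) (z : ι → Z) (r : ι → ℝ)
    (hT : (T : Set ι).Pairwise fun i j => Disjoint (ball (z i) (r i)) (ball (z j) (r j))) :
    ∑ i ∈ T, ballOscillation ν u (z i) (r i) ≤ 2 * eLpNorm u 1 ν := by
  calc ∑ i ∈ T, ballOscillation ν u (z i) (r i)
      ≤ ∑ i ∈ T, 2 * ∫⁻ y in ball (z i) (r i), ‖u y‖ₑ ∂ν :=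
        Finset.sum_le_sum fun i _ => ballOscillation_le_two_mul hu (hfin _ _)
    _ = 2 * ∫⁻ y in ⋃ i ∈ T, ball (z i) (r i), ‖u y‖ₑ ∂ν := by
        rw [← Finset.mul_sum, lintegral_biUnion_finset hT fun _ _ => measurableSet_ball]
    _ ≤ _ := by
        rw [eLpNorm_one_eq_lintegral_enorm]
        gcongr
        exact Measure.restrict_le_self

variable [BorelSpace Z] in
theorem johnNirenbergEnergy_zero_le (hfin : ∀ (z : Z) r, ν (ball z r) < ∞) {u : Z → ℝ}
    (hu : AEStronglyMeasurable u ν) (R τ : ℝ) :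
    johnNirenbergEnergy ν R τ 0 u ≤ 2 * eLpNorm u 1 ν := by
  refine iSup₂_le fun 𝓑 h𝓑 => ?_
  rw [ENNReal.tsum_eq_iSup_sum]
  refine iSup_le fun T => ?_
  simp only [Real.rpow_zero, ENNReal.ofReal_one, div_one]
  exact sum_ballOscillation_le hu hfin T (fun B => B.1.1) (fun B => τ * B.1.2)
    fun i _ j _ hij => h𝓑.2 i.2 j.2 fun e => hij (Subtype.ext e)

/-- Sums of oscillations over disjoint balls of a common radius are controlled by the
John–Nirenberg energy. -/
theorem sum_ballOscillation_le_johnNirenbergEnergy {u : Z → ℝ} {R τ θ t : ℝ} (hτ : 1 ≤ τ)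
    (ht : 0 < t) (htR : t ≤ R) (T : Finset Z)
    (hT : (T : Set Z).Pairwise fun x y => Disjoint (ball x t) (ball y t)) :
    ∑ z ∈ T, ballOscillation ν u z t ≤
      ENNReal.ofReal ((t / τ) ^ θ) * johnNirenbergEnergy ν R τ θ u := by
  have hτ0 : 0 < τ := by linarith
  have hr : τ * (t / τ) = t := mul_div_cancel₀ _ hτ0.ne'
  have hpos : 0 < (t / τ) ^ θ := by positivity
  -- The radius `t / τ` makes the inflated balls exactly the given ones of radius `t`.
  obtain ⟨e, he⟩ : ∃ e : Z ↪ Z × ℝ, ∀ z, e z = (z, t / τ) :=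
    ⟨⟨fun z => (z, t / τ), fun x y h => congrArg Prod.fst h⟩, fun _ => rfl⟩
  have hadm : IsAdmissibleFamily R τ (T.map e : Set (Z × ℝ)) := by
    constructor
    · intro B hB
      obtain ⟨z, hz, rfl⟩ := Finset.mem_map.1 (Finset.mem_coe.1 hB)
      exact ⟨by rw [he]; positivity, by rw [he]; exact div_le_div_of_nonneg_right htR hτ0.le⟩
    · intro B hB B' hB' hne
      obtain ⟨z, hz, rfl⟩ := Finset.mem_map.1 (Finset.mem_coe.1 hB)
      obtain ⟨z', hz', rfl⟩ := Finset.mem_map.1 (Finset.mem_coe.1 hB')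
      simp only [he, hr]
      exact hT hz hz' fun h => hne (by rw [h])
  have hle := le_iSup₂ (f := fun (𝓑 : Set (Z × ℝ)) (_ : IsAdmissibleFamily R τ 𝓑) =>
    ∑' B : 𝓑, ballOscillation ν u B.1.1 (τ * B.1.2) / ENNReal.ofReal (B.1.2 ^ θ)) _ hadm
  change _ ≤ johnNirenbergEnergy ν R τ θ u at hle
  rw [Finset.tsum_subtype' (T.map e)
    fun B => ballOscillation ν u B.1 (τ * B.2) / ENNReal.ofReal (B.2 ^ θ), Finset.sum_map] at hle
  simp only [he, hr] at hle
  calc ∑ z ∈ T, ballOscillation ν u z t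
      = ∑ z ∈ T, ENNReal.ofReal ((t / τ) ^ θ) *
          (ballOscillation ν u z t / ENNReal.ofReal ((t / τ) ^ θ)) := by
        refine Finset.sum_congr rfl fun z _ => ?_
        rw [ENNReal.mul_div_cancel (by simpa using hpos) ENNReal.ofReal_ne_top]
    _ ≤ _ := by rw [← Finset.mul_sum]; gcongr

/-- Admissible radii are at most `R / τ`, so passing to a larger exponent costs at most `(R / τ) ^
(θ' - θ)` per term. -/
theorem johnNirenbergEnergy_le_of_le {R τ θ θ' : ℝ} (hR : 0 < R) (hτ : 1 ≤ τ) (hθ : θ ≤ θ')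
    (u : Z → ℝ) :
    johnNirenbergEnergy ν R τ θ u ≤
      ENNReal.ofReal ((R / τ) ^ (θ' - θ)) * johnNirenbergEnergy ν R τ θ' u := by
  refine iSup₂_le fun 𝓑 h𝓑 => ?_
  have hle := le_iSup₂ (f := fun (𝓑 : Set (Z × ℝ)) (_ : IsAdmissibleFamily R τ 𝓑) =>
    ∑' B : 𝓑, ballOscillation ν u B.1.1 (τ * B.1.2) / ENNReal.ofReal (B.1.2 ^ θ')) 𝓑 h𝓑
  refine le_trans ?_ (mul_le_mul_right hle _)
  rw [← ENNReal.tsum_mul_left]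
  refine ENNReal.tsum_le_tsum fun B => ?_
  obtain ⟨h0, h1⟩ := h𝓑.1 B.1 B.2
  have hp : 0 < B.1.2 ^ θ := by positivity
  have hp' : 0 < B.1.2 ^ θ' := by positivity
  rw [div_eq_mul_inv, div_eq_mul_inv (ballOscillation _ _ _ _), mul_left_comm]
  gcongr
  rw [← ENNReal.ofReal_inv_of_pos hp, ← ENNReal.ofReal_inv_of_pos hp',
    ← ENNReal.ofReal_mul (by positivity)]
  refine ENNReal.ofReal_le_ofReal ?_
  calc (B.1.2 ^ θ)⁻¹ = B.1.2 ^ (θ' - θ) * (B.1.2 ^ θ')⁻¹ := by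
        rw [Real.rpow_sub h0]; field_simp
    _ ≤ _ := by
        have : B.1.2 ^ (θ' - θ) ≤ (R / τ) ^ (θ' - θ) :=
          Real.rpow_le_rpow h0.le h1 (sub_nonneg.2 hθ)
        gcongr

end

namespace DoublingWith

variable {Z : Type*} [MetricSpace Z] [MeasurableSpace Z] {ν : Measure Z} {C : ℝ≥0}

/-- Follows from `ball x t ⊆ ball z (2t) ⊆ ball x (4t)`; two doublings give `C ^ 2`. -/
theorem laverage_ball_le (h : DoublingWith ν C) {x z : Z} {t : ℝ} (ht : 0 < t)
    (hx : x ∈ ball z t) (f : Z → ℝ≥0∞) :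
    ⨍⁻ y in ball x t, f y ∂ν ≤ C ^ 2 * ((ν (ball z (2 * t)))⁻¹ * ∫⁻ y in ball z (2 * t), f y ∂ν) := by
  rw [setLAverage_eq, ENNReal.div_eq_inv_mul, ← mul_assoc]
  have hx' := mem_ball.1 hx
  have hsub : ball x t ⊆ ball z (2 * t) := ball_subset_ball' (by linarith)
  have hm : ν (ball z (2 * t)) ≤ C ^ 2 * ν (ball x t) :=
    h.measure_ball_le ht 2 (by rw [dist_comm]; linarith)
  gcongr
  rw [← div_eq_mul_inv, ENNReal.le_div_iff_mul_le (Or.inl (h.pos _ _ (by positivity)).ne')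
    (Or.inl (h.finite _ _).ne), mul_comm, ← div_eq_mul_inv]
  exact ENNReal.div_le_of_le_mul hm

variable [BorelSpace Z]

/-- The mean oscillation at scale `t` in terms of the oscillations over the balls of a net. -/
theorem scaleOscillation_le_tsum (h : DoublingWith ν C) {u : Z → ℝ}
    {t : ℝ} (ht : 0 < t) {S : Set Z} (hS : IsNet t S) :
    scaleOscillation ν u t ≤ 2 * C ^ 2 * ∑' z : S, ballOscillation ν u z (2 * t) := by
  have hSc : Countable S := (h.countable_of_separated ht hS.separated).to_subtype
  have key : ∀ z : Z, ∫⁻ x in ball z t, (⨍⁻ y in ball x t, ‖u y - u x‖ₑ ∂ν) ∂ν ≤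
      2 * C ^ 2 * ballOscillation ν u z (2 * t) := by
    intro z
    set c := ⨍ w in ball z (2 * t), u w ∂ν
    set V := ν (ball z (2 * t)) with hV
    have hV0 : V ≠ 0 := (h.pos _ _ (by positivity)).ne'
    have hVt : V ≠ ∞ := (h.finite _ _).ne
    -- Comparing `u x` and `u y` with the mean `c` leaves a term in `x` and a constant. Each
    -- integrates to at most `C ^ 2` times the oscillation over the doubled ball, whence the factor
    -- 2.
    have hpt : ∀ x ∈ ball z t, ⨍⁻ y in ball x t, ‖u y - u x‖ₑ ∂ν ≤
        C ^ 2 * ‖u x - c‖ₑ + C ^ 2 * (V⁻¹ * ballOscillation ν u z (2 * t)) := by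
      intro x hx
      refine (h.laverage_ball_le ht hx _).trans ?_
      rw [← mul_add]
      gcongr
      calc V⁻¹ * ∫⁻ y in ball z (2 * t), ‖u y - u x‖ₑ ∂ν
          ≤ V⁻¹ * ∫⁻ y in ball z (2 * t), (‖u x - c‖ₑ + ‖u y - c‖ₑ) ∂ν := by
            gcongr with y
            calc ‖u y - u x‖ₑ = ‖(u y - c) - (u x - c)‖ₑ := by ring_nf
              _ ≤ _ := by rw [add_comm]; exact enorm_sub_le
        _ = ‖u x - c‖ₑ + V⁻¹ * ballOscillation ν u z (2 * t) := by
            rw [lintegral_add_left measurable_const, setLIntegral_const, ← hV, mul_add,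
              mul_comm ‖u x - c‖ₑ, ← mul_assoc, ENNReal.inv_mul_cancel hV0 hVt, one_mul]
            rfl
    calc ∫⁻ x in ball z t, (⨍⁻ y in ball x t, ‖u y - u x‖ₑ ∂ν) ∂ν
        ≤ ∫⁻ x in ball z t, (C ^ 2 * ‖u x - c‖ₑ +
            C ^ 2 * (V⁻¹ * ballOscillation ν u z (2 * t))) ∂ν :=
          setLIntegral_mono' measurableSet_ball hpt
      _ ≤ ∫⁻ x in ball z (2 * t), (C ^ 2 * ‖u x - c‖ₑ +
            C ^ 2 * (V⁻¹ * ballOscillation ν u z (2 * t))) ∂ν :=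
          lintegral_mono_set (ball_subset_ball (by linarith))
      _ = C ^ 2 * ballOscillation ν u z (2 * t) +
            C ^ 2 * (V⁻¹ * ballOscillation ν u z (2 * t)) * V := by
          rw [lintegral_add_right _ measurable_const, setLIntegral_const,
            lintegral_const_mul' _ _ (by finiteness)]
          rfl
      _ = C ^ 2 * ballOscillation ν u z (2 * t) +
            C ^ 2 * ((V⁻¹ * V) * ballOscillation ν u z (2 * t)) := by ring
      _ = _ := by rw [ENNReal.inv_mul_cancel hV0 hVt]; ring
  calc scaleOscillation ν u t
      = ∫⁻ x in ⋃ z : S, ball (z : Z) t, (⨍⁻ y in ball x t, ‖u y - u x‖ₑ ∂ν) ∂ν := by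
        rw [show ⋃ z : S, ball (z : Z) t = univ from eq_univ_of_forall fun x => by
          obtain ⟨z, hz, hd⟩ := hS.cover x
          exact mem_iUnion.2 ⟨⟨z, hz⟩, hd⟩, Measure.restrict_univ]
        rfl
    _ ≤ ∑' z : S, ∫⁻ x in ball (z : Z) t, (⨍⁻ y in ball x t, ‖u y - u x‖ₑ ∂ν) ∂ν :=
        lintegral_iUnion_le _ _
    _ ≤ ∑' z : S, 2 * C ^ 2 * ballOscillation ν u z (2 * t) := ENNReal.tsum_le_tsum fun z => key z
    _ = _ := ENNReal.tsum_mul_left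

theorem tsum_net_ballOscillation_le (h : DoublingWith ν C) {u : Z → ℝ} {R τ θ t : ℝ} (hτ : 1 ≤ τ)
    (ht : 0 < t) (htR : 2 * t ≤ R) {S : Set Z} (hS : IsNet t S) :
    ∑' z : S, ballOscillation ν u z (2 * t) ≤ (⌊C ^ 5⌋₊ + 1 : ℕ) *
      (ENNReal.ofReal ((2 * t / τ) ^ θ) * johnNirenbergEnergy ν R τ θ u) :=
  h.tsum_net_le ht hS.separated (fun z => ballOscillation ν u z (2 * t)) _ fun T hT =>
    sum_ballOscillation_le_johnNirenbergEnergy hτ (by positivity) htR T hT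

/-- Serves the scales with `2t > R`, where balls of radius `2t` are too large to be inflations of
admissible ones. -/
theorem scaleOscillation_le_eLpNorm (h : DoublingWith ν C) {u : Z → ℝ}
    (hu : AEStronglyMeasurable u ν) {t : ℝ} (ht : 0 < t) :
    scaleOscillation ν u t ≤
      2 * C ^ 2 * ((⌊C ^ 5⌋₊ + 1 : ℕ) * (2 * eLpNorm u 1 ν)) := by
  obtain ⟨S, hS⟩ := exists_isNet (Z := Z) ht
  refine (h.scaleOscillation_le_tsum ht hS).trans ?_
  gcongr
  exact h.tsum_net_le ht hS.separated (fun z => ballOscillation ν u z (2 * t)) _ fun T hT =>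
    sum_ballOscillation_le hu h.finite T id (fun _ => 2 * t) hT

theorem scaleOscillation_le_johnNirenbergEnergy (h : DoublingWith ν C) {u : Z → ℝ}
    {R τ θ t : ℝ} (hτ : 1 ≤ τ) (ht : 0 < t) (htR : 2 * t ≤ R) :
    scaleOscillation ν u t ≤ 2 * C ^ 2 * ((⌊C ^ 5⌋₊ + 1 : ℕ) *
      (ENNReal.ofReal ((2 * t / τ) ^ θ) * johnNirenbergEnergy ν R τ θ u)) := by
  obtain ⟨S, hS⟩ := exists_isNet (Z := Z) ht
  refine (h.scaleOscillation_le_tsum ht hS).trans ?_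
  gcongr
  exact h.tsum_net_ballOscillation_le hτ ht htR hS

end DoublingWith

/-! ### The inclusions other than `BV`, and Lipschitz functions -/

namespace DoublingWith

variable {Z : Type*} [MetricSpace Z] [MeasurableSpace Z] {ν : Measure Z} {C : ℝ≥0}

variable [BorelSpace Z] in
theorem L1Space_eq_johnNirenbergSpace (h : DoublingWith ν C) (R τ : ℝ) :
    L1Space ν = JohnNirenbergSpace ν R τ 0 := by
  ext u
  refine ⟨fun hu => ⟨hu.1, ?_⟩, fun hu => ⟨hu.1, le_self_add.trans_lt hu.2⟩⟩
  refine ENNReal.add_lt_top.2 ⟨hu.2, ?_⟩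
  exact (johnNirenbergEnergy_zero_le h.finite hu.1 R τ).trans_lt
    (ENNReal.mul_lt_top (by finiteness) hu.2)

theorem besovSpace_subset_L1Space (R θ : ℝ) : BesovSpace ν R θ ⊆ L1Space ν :=
  fun _ hu => ⟨hu.1, le_self_add.trans_lt hu.2⟩

variable [BorelSpace Z] in
-- For `2t ≤ R` the integrand is `O(t^(θ-1))`, integrable at 0 because `θ > 0`; for larger `t` the
-- `L¹` bound divided by `R / 2` suffices.
theorem johnNirenbergSpace_subset_besovSpace (h : DoublingWith ν C) {R τ θ : ℝ} (hR : 0 < R)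
    (hτ : 1 ≤ τ) (hθ : 0 < θ) : JohnNirenbergSpace ν R τ θ ⊆ BesovSpace ν R 0 := by
  intro u hu
  obtain ⟨hL, hJ⟩ := ENNReal.add_lt_top.1 hu.2
  refine ⟨hu.1, ENNReal.add_lt_top.2 ⟨hL, ?_⟩⟩
  have hτ0 : 0 < τ := by linarith
  set N : ℝ≥0∞ := ((⌊C ^ 5⌋₊ + 1 : ℕ) : ℝ≥0∞) with hN
  have hNt : N < ∞ := by rw [hN]; finiteness
  set A : ℝ≥0∞ := 2 * C ^ 2 *
    (N * (ENNReal.ofReal ((2 / τ) ^ θ) * johnNirenbergEnergy ν R τ θ u)) with hA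
  set D : ℝ≥0∞ := 2 * C ^ 2 * (N * (2 * eLpNorm u 1 ν)) with hD
  have hAt : A < ∞ := ENNReal.mul_lt_top (by finiteness)
    (ENNReal.mul_lt_top hNt (ENNReal.mul_lt_top (by finiteness) hJ))
  have hDt : D < ∞ := ENNReal.mul_lt_top (by finiteness)
    (ENNReal.mul_lt_top hNt (ENNReal.mul_lt_top (by finiteness) hL))
  have hR2 : 0 < ENNReal.ofReal (R / 2) := by simpa using hR
  have hpt : ∀ t ∈ Ioo 0 R, scaleOscillation ν u t / ENNReal.ofReal (t ^ (1 + (0 : ℝ))) ≤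
      A * ENNReal.ofReal (t ^ (θ - 1)) + D / ENNReal.ofReal (R / 2) := by
    intro t ht
    have ht0 := ht.1
    rw [add_zero, Real.rpow_one]
    rcases le_or_gt (2 * t) R with h2 | h2
    · refine le_add_right ?_
      refine ENNReal.div_le_of_le_mul ((h.scaleOscillation_le_johnNirenbergEnergy (θ := θ)
        hτ ht0 h2).trans (le_of_eq ?_))
      have : (2 * t / τ) ^ θ = (2 / τ) ^ θ * (t ^ (θ - 1) * t) := by
        rw [mul_div_right_comm, Real.mul_rpow (by positivity) ht0.le, Real.rpow_sub_one ht0.ne',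
          div_mul_cancel₀ _ ht0.ne']
      rw [this, hA, ENNReal.ofReal_mul (by positivity), ENNReal.ofReal_mul (by positivity)]
      ring
    · refine le_add_left ?_
      gcongr
      · exact h.scaleOscillation_le_eLpNorm hu.1 ht0
      · linarith
  calc besovEnergy ν R 0 u
      ≤ ∫⁻ t in Ioo 0 R, (A * ENNReal.ofReal (t ^ (θ - 1)) + D / ENNReal.ofReal (R / 2)) :=
        setLIntegral_mono' measurableSet_Ioo hpt
    _ = A * (∫⁻ t in Ioo 0 R, ENNReal.ofReal (t ^ (θ - 1))) +
          D / ENNReal.ofReal (R / 2) * volume (Ioo 0 R) := by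
        rw [lintegral_add_right _ measurable_const, setLIntegral_const,
          lintegral_const_mul' _ _ hAt.ne]
    _ < ∞ := by
        refine ENNReal.add_lt_top.2 ⟨ENNReal.mul_lt_top hAt ?_,
          ENNReal.mul_lt_top (ENNReal.div_lt_top hDt.ne hR2.ne') (by simp)⟩
        have hi := (intervalIntegral.intervalIntegrable_rpow' (a := 0) (b := R)
          (r := θ - 1) (by linarith)).1
        exact (hi.mono_set Ioo_subset_Ioc_self).lintegral_lt_top

theorem johnNirenbergSpace_anti {R τ θ θ' : ℝ} (hR : 0 < R) (hτ : 1 ≤ τ) (hθ : θ ≤ θ') :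
    JohnNirenbergSpace ν R τ θ' ⊆ JohnNirenbergSpace ν R τ θ := by
  intro u hu
  obtain ⟨hL, hJ⟩ := ENNReal.add_lt_top.1 hu.2
  exact ⟨hu.1, ENNReal.add_lt_top.2 ⟨hL, (johnNirenbergEnergy_le_of_le hR hτ hθ u).trans_lt
    (ENNReal.mul_lt_top (by finiteness) hJ)⟩⟩

variable [BorelSpace Z] in
-- The oscillation at scale `t` is at most `K t ν(Z)`, which cancels the weight `1/t`; boundedness
-- makes `ν(Z)` finite.
theorem lipschitzWith_mem_besovSpace (h : DoublingWith ν C)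
    (hb : Bornology.IsBounded (univ : Set Z)) (R : ℝ) {K : ℝ≥0} {u : Z → ℝ}
    (hu : LipschitzWith K u) : u ∈ BesovSpace ν R 0 := by
  have hmeas : Measurable u := hu.continuous.measurable
  have hfin : ν univ < ∞ := by
    rcases isEmpty_or_nonempty Z with hZ | ⟨⟨z⟩⟩
    · simp [univ_eq_empty_iff.2 hZ]
    · obtain ⟨r, hr⟩ := hb.subset_ball z
      exact (measure_mono hr).trans_lt (h.finite z r)
  have : IsFiniteMeasure ν := ⟨hfin⟩
  refine ⟨hmeas.aestronglyMeasurable, ENNReal.add_lt_top.2 ⟨?_, ?_⟩⟩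
  · have hbd : Bornology.IsBounded (range u) := by
      rw [← image_univ]; exact hu.isBounded_image hb
    obtain ⟨M, hM⟩ := hbd.exists_norm_le
    exact (MemLp.of_bound hmeas.aestronglyMeasurable M
      (Eventually.of_forall fun x => hM _ (mem_range_self x))).2
  · have hpt : ∀ t ∈ Ioo 0 R, scaleOscillation ν u t / ENNReal.ofReal (t ^ (1 + (0 : ℝ))) ≤
        K * ν univ := by
      intro t ht
      have ht0 := ht.1
      rw [add_zero, Real.rpow_one]
      refine ENNReal.div_le_of_le_mul ?_
      calc scaleOscillation ν u t ≤ ∫⁻ _, K * ENNReal.ofReal t ∂ν := by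
            refine lintegral_mono fun x => ?_
            rw [setLAverage_eq]
            refine ENNReal.div_le_of_le_mul ?_
            rw [← setLIntegral_const]
            refine setLIntegral_mono' measurableSet_ball fun y hy => ?_
            rw [← edist_eq_enorm_sub]
            refine (hu y x).trans ?_
            gcongr
            rw [edist_dist]
            exact ENNReal.ofReal_le_ofReal (mem_ball.1 hy).le
        _ = K * ν univ * ENNReal.ofReal t := by rw [lintegral_const]; ring
    calc besovEnergy ν R 0 u ≤ ∫⁻ t in Ioo 0 R, K * ν univ :=
          setLIntegral_mono' measurableSet_Ioo hpt
      _ < ∞ := by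
          rw [setLIntegral_const, Real.volume_Ioo]
          finiteness

end DoublingWith

/-! ### Tent averages and the inclusion in `BV` -/

/-- The tent function of height and radius `ε` centred at `x`. -/
noncomputable def tent {Z : Type*} [MetricSpace Z] (ε : ℝ) (x y : Z) : ℝ :=
  max (ε - dist x y) 0

/-- The average of `u` against the tent function centred at `x`. -/
noncomputable def tentAverage {Z : Type*} [MetricSpace Z] [MeasurableSpace Z] (ν : Measure Z)
    (ε : ℝ) (u : Z → ℝ) (x : Z) : ℝ :=
  (∫ y, tent ε x y * u y ∂ν) / ∫ y, tent ε x y ∂ν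

section

variable {Z : Type*} [MetricSpace Z] {ε : ℝ}

theorem tent_nonneg (x y : Z) : 0 ≤ tent ε x y := le_max_right _ _

theorem tent_le (hε : 0 ≤ ε) (x y : Z) : tent ε x y ≤ ε :=
  max_le (sub_le_self _ dist_nonneg) hε

theorem abs_tent_le (hε : 0 ≤ ε) (x y : Z) : |tent ε x y| ≤ ε := by
  rw [abs_of_nonneg (tent_nonneg x y)]; exact tent_le hε x y

theorem half_le_tent {x y : Z} (hy : y ∈ ball x (ε / 2)) : ε / 2 ≤ tent ε x y := by
  rw [mem_ball'] at hy
  exact le_max_of_le_left (by linarith)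

theorem tent_eq_zero {x y : Z} (hy : y ∉ ball x ε) : tent ε x y = 0 := by
  rw [mem_ball', not_lt] at hy
  exact max_eq_right (by linarith)

theorem abs_tent_sub_le (x x' y : Z) : |tent ε x y - tent ε x' y| ≤ dist x x' := by
  refine (abs_max_sub_max_le_abs _ _ _).trans ?_
  rw [show ε - dist x y - (ε - dist x' y) = dist x' y - dist x y by ring, dist_comm x x']
  exact abs_dist_sub_le x' x y

theorem continuous_tent (x : Z) : Continuous (tent ε x) := by
  unfold tent; fun_prop

end

theorem abs_integral_mul_le_of_support {Z : Type*} [MeasurableSpace Z] {ν : Measure Z} {B : Set Z}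
    (hB : MeasurableSet B) {k w : Z → ℝ} {M : ℝ} (hk : ∀ y, |k y| ≤ M) (hk0 : ∀ y ∉ B, k y = 0)
    (hw : IntegrableOn w B ν) : |∫ y, k y * w y ∂ν| ≤ M * ∫ y in B, |w y| ∂ν := by
  rw [← integral_const_mul, ← integral_indicator hB]
  rw [← Real.norm_eq_abs]
  refine norm_integral_le_of_norm_le ((integrable_indicator_iff hB).2 (hw.norm.const_mul M))
    (Eventually.of_forall fun y => ?_)
  by_cases hy : y ∈ B
  · rw [indicator_of_mem hy, norm_mul]
    exact mul_le_mul_of_nonneg_right (hk y) (norm_nonneg _)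
  · simp [hk0 y hy, hy]

namespace DoublingWith

variable {Z : Type*} [MetricSpace Z] [MeasurableSpace Z] [BorelSpace Z] {ν : Measure Z} {C : ℝ≥0}
  {ε : ℝ}

theorem integrable_tent (h : DoublingWith ν C) (hε : 0 ≤ ε) (x : Z) :
    Integrable (tent ε x) ν := by
  refine Integrable.mono' (g := (ball x ε).indicator fun _ => ε) ?_
    (continuous_tent x).measurable.aestronglyMeasurable (Eventually.of_forall fun y => ?_)
  · exact (integrable_indicator_iff measurableSet_ball).2 (integrableOn_const (h.finite _ _).ne)
  · by_cases hy : y ∈ ball x ε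
    · rw [indicator_of_mem hy]; exact abs_tent_le hε x y
    · rw [indicator_of_notMem hy, tent_eq_zero hy, norm_zero]

theorem integrable_tent_mul (hε : 0 ≤ ε) (x : Z) {u : Z → ℝ} (hu : Integrable u ν) :
    Integrable (fun y => tent ε x y * u y) ν :=
  hu.bdd_mul (c := ε) (continuous_tent x).measurable.aestronglyMeasurable
    (Eventually.of_forall fun y => abs_tent_le hε x y)

/-- Bounds the normalising mass below: the tent is at least `ε / 2` on `ball x (ε / 2)`, which
doubling compares with `ball z r`. -/
theorem measureReal_ball_le_integral_tent (h : DoublingWith ν C) (hε : 0 < ε) {x z : Z} {r : ℝ}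
    (n : ℕ) (hd : r + dist z x ≤ 2 ^ n * (ε / 2)) :
    ε * ν.real (ball z r) ≤ 2 * C ^ n * ∫ y, tent ε x y ∂ν := by
  have h1 : ε / 2 * ν.real (ball x (ε / 2)) ≤ ∫ y, tent ε x y ∂ν := by
    calc ε / 2 * ν.real (ball x (ε / 2)) = ∫ y in ball x (ε / 2), ε / 2 ∂ν := by
          rw [setIntegral_const, smul_eq_mul, mul_comm]
      _ ≤ ∫ y in ball x (ε / 2), tent ε x y ∂ν :=
          setIntegral_mono_on (integrableOn_const (h.finite _ _).ne)
            (h.integrable_tent hε.le x).integrableOn measurableSet_ball fun y hy => half_le_tent hy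
      _ ≤ ∫ y, tent ε x y ∂ν := setIntegral_le_integral (h.integrable_tent hε.le x)
            (Eventually.of_forall fun y => tent_nonneg x y)
  have h2 : ν.real (ball z r) ≤ C ^ n * ν.real (ball x (ε / 2)) := by
    have := ENNReal.toReal_mono (by have := (h.finite x (ε / 2)).ne; finiteness)
      (h.measure_ball_le (x := z) (half_pos hε) n hd)
    simpa [Measure.real] using this
  calc ε * ν.real (ball z r) ≤ ε * (C ^ n * ν.real (ball x (ε / 2))) := by gcongr
    _ = 2 * C ^ n * (ε / 2 * ν.real (ball x (ε / 2))) := by ring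
    _ ≤ _ := by gcongr

theorem integral_tent_pos (h : DoublingWith ν C) (hε : 0 < ε) (x : Z) :
    0 < ∫ y, tent ε x y ∂ν := by
  have h1 := h.measureReal_ball_le_integral_tent hε (x := x) (z := x) (r := ε / 2) 0 (by simp)
  have h2 : 0 < ν.real (ball x (ε / 2)) :=
    ENNReal.toReal_pos (h.pos _ _ (half_pos hε)).ne' (h.finite _ _).ne
  have : 0 < ε * ν.real (ball x (ε / 2)) := by positivity
  rw [pow_zero, mul_one] at h1
  linarith

/-- Normalised averages reproduce constants, so estimates can involve the oscillation of `u` rather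
than its size. -/
theorem tentAverage_sub_const (h : DoublingWith ν C) (hε : 0 < ε) {u : Z → ℝ}
    (hu : Integrable u ν) (x : Z) (c : ℝ) :
    tentAverage ν ε u x - c = (∫ y, tent ε x y * (u y - c) ∂ν) / ∫ y, tent ε x y ∂ν := by
  have hN := (h.integral_tent_pos hε x).ne'
  simp_rw [mul_sub]
  rw [integral_sub (integrable_tent_mul hε.le x hu) ((h.integrable_tent hε.le x).mul_const c),
    integral_mul_const, sub_div, mul_div_cancel_left₀ _ hN]
  rfl

/-- The tent averages are Lipschitz on balls, with constant controlled by the oscillation. -/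
theorem abs_tentAverage_sub_le (h : DoublingWith ν C) (hε : 0 < ε) {u : Z → ℝ}
    (hu : Integrable u ν) {z x x' : Z} (hx : x ∈ ball z ε) (hx' : x' ∈ ball z ε) :
    |tentAverage ν ε u x - tentAverage ν ε u x'| ≤
      (2 * C ^ 3 + 4 * C ^ 6) / ε * ((ballOscillation ν u z (2 * ε)).toReal /
        ν.real (ball z (2 * ε))) * dist x x' := by
  set B := ball z (2 * ε) with hBdef
  set c := ⨍ w in B, u w ∂ν with hc
  have hB : MeasurableSet B := measurableSet_ball
  have hw : IntegrableOn (fun y => u y - c) B ν :=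
    hu.integrableOn.sub (integrableOn_const (h.finite _ _).ne)
  have hO : (ballOscillation ν u z (2 * ε)).toReal = ∫ y in B, |u y - c| ∂ν :=
    (integral_norm_eq_lintegral_enorm hw.1).symm
  set O := ∫ y in B, |u y - c| ∂ν
  have hO0 : 0 ≤ O := integral_nonneg fun _ => abs_nonneg _
  rw [hO]
  set V := ν.real B
  have hV : 0 < V := ENNReal.toReal_pos (h.pos _ _ (by positivity)).ne' (h.finite _ _).ne
  have hsub : ∀ w ∈ ball z ε, ball w ε ⊆ B := fun w hwz => ball_subset_ball' (by
    have := mem_ball.1 hwz; linarith)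
  -- The exponent 3 comes from `2ε + ε ≤ 2^3 · (ε/2)`.
  have hmass : ∀ w ∈ ball z ε, ε * V ≤ 2 * C ^ 3 * ∫ y, tent ε w y ∂ν := fun w hwz =>
    h.measureReal_ball_le_integral_tent hε 3 (by have := mem_ball'.1 hwz; linarith)
  set N := ∫ y, tent ε x y ∂ν with hN
  set N' := ∫ y, tent ε x' y ∂ν with hN'
  have hN0 : 0 < N := h.integral_tent_pos hε x
  have hN0' : 0 < N' := h.integral_tent_pos hε x'
  set W := ∫ y, tent ε x y * (u y - c) ∂ν with hW
  set W' := ∫ y, tent ε x' y * (u y - c) ∂ν with hW'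
  have hint : ∀ w, Integrable (fun y => tent ε w y * (u y - c)) ν := fun w => by
    simp_rw [mul_sub]
    exact (integrable_tent_mul hε.le w hu).sub ((h.integrable_tent hε.le w).mul_const c)
  have hdiff0 : ∀ y ∉ B, tent ε x y - tent ε x' y = 0 := fun y hy => by
    rw [tent_eq_zero fun hm => hy (hsub x hx hm), tent_eq_zero fun hm => hy (hsub x' hx' hm),
      sub_zero]
  have h1 : |W - W'| ≤ dist x x' * O := by
    rw [hW, hW', ← integral_sub (hint x) (hint x')]
    simp_rw [← sub_mul]
    exact abs_integral_mul_le_of_support hB (abs_tent_sub_le x x') hdiff0 hw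
  have h2 : |W'| ≤ ε * O :=
    abs_integral_mul_le_of_support hB (abs_tent_le hε.le x')
      (fun y hy => tent_eq_zero fun hm => hy (hsub x' hx' hm)) hw
  have h3 : |N - N'| ≤ dist x x' * V := by
    rw [hN, hN', ← integral_sub (h.integrable_tent hε.le x) (h.integrable_tent hε.le x')]
    have := abs_integral_mul_le_of_support (ν := ν) (w := fun _ => 1) hB (abs_tent_sub_le x x')
      hdiff0 (integrableOn_const (h.finite _ _).ne)
    simpa using this
  -- Numerator and denominator are varied separately. The first term needs one mass bound and yields
  -- `2 * C ^ 3`; the second needs two and yields `4 * C ^ 6`.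
  have hkey : tentAverage ν ε u x - tentAverage ν ε u x' =
      (W - W') / N + W' * (N' - N) / (N * N') := by
    rw [← sub_sub_sub_cancel_right _ _ c, h.tentAverage_sub_const hε hu,
      h.tentAverage_sub_const hε hu]
    change W / N - W' / N' = _
    field_simp
    ring
  have hiN : 1 / N ≤ 2 * C ^ 3 / (ε * V) := by
    rw [div_le_div_iff₀ hN0 (by positivity), one_mul]; exact hmass x hx
  have hiN' : 1 / N' ≤ 2 * C ^ 3 / (ε * V) := by
    rw [div_le_div_iff₀ hN0' (by positivity), one_mul]; exact hmass x' hx'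
  rw [hkey]
  calc |(W - W') / N + W' * (N' - N) / (N * N')|
      ≤ |(W - W') / N| + |W' * (N' - N) / (N * N')| := abs_add_le _ _
    _ = |W - W'| * (1 / N) + |W'| * |N - N'| * ((1 / N) * (1 / N')) := by
        rw [abs_div, abs_div, abs_mul, abs_of_pos hN0, abs_of_pos (mul_pos hN0 hN0'),
          abs_sub_comm N' N]
        field_simp
    _ ≤ dist x x' * O * (2 * C ^ 3 / (ε * V)) +
          ε * O * (dist x x' * V) * ((2 * C ^ 3 / (ε * V)) * (2 * C ^ 3 / (ε * V))) := by
        gcongr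
    _ = _ := by field_simp; ring

theorem enorm_tentAverage_sub_le (h : DoublingWith ν C) (hε : 0 < ε) {u : Z → ℝ}
    (hu : Integrable u ν) (x : Z) :
    ‖tentAverage ν ε u x - u x‖ₑ ≤ 2 * C * ⨍⁻ y in ball x ε, ‖u y - u x‖ₑ ∂ν := by
  have hw : IntegrableOn (fun y => u y - u x) (ball x ε) ν :=
    hu.integrableOn.sub (integrableOn_const (h.finite _ _).ne)
  have hV : 0 < ν.real (ball x ε) :=
    ENNReal.toReal_pos (h.pos _ _ hε).ne' (h.finite _ _).ne
  have hN0 := h.integral_tent_pos hε x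
  have hN := h.measureReal_ball_le_integral_tent hε (x := x) (z := x) (r := ε) 1
    (by rw [dist_self]; linarith)
  have h1 := abs_integral_mul_le_of_support (ν := ν) measurableSet_ball (abs_tent_le hε.le x)
    (fun y => tent_eq_zero) hw
  have h2 : |tentAverage ν ε u x - u x| ≤
      2 * C * ((∫ y in ball x ε, |u y - u x| ∂ν) / ν.real (ball x ε)) := by
    rw [h.tentAverage_sub_const hε hu, abs_div, abs_of_pos hN0, div_le_iff₀ hN0]
    refine h1.trans ?_
    have hI : 0 ≤ ∫ y in ball x ε, |u y - u x| ∂ν := integral_nonneg fun _ => abs_nonneg _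
    rw [pow_one] at hN
    calc ε * ∫ y in ball x ε, |u y - u x| ∂ν
        = (ε * ν.real (ball x ε)) * ((∫ y in ball x ε, |u y - u x| ∂ν) / ν.real (ball x ε)) := by
          field_simp
      _ ≤ (2 * C * ∫ y, tent ε x y ∂ν) *
            ((∫ y in ball x ε, |u y - u x| ∂ν) / ν.real (ball x ε)) := by gcongr
      _ = _ := by ring
  have h3 : ENNReal.ofReal (∫ y in ball x ε, |u y - u x| ∂ν) =
      ∫⁻ y in ball x ε, ‖u y - u x‖ₑ ∂ν := ofReal_integral_norm_eq_lintegral_enorm hw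
  rw [setLAverage_eq, ← h3, ← ofReal_measureReal (h.finite x ε).ne, ← ENNReal.ofReal_div_of_pos hV,
    ← ofReal_norm, Real.norm_eq_abs]
  refine (ENNReal.ofReal_le_ofReal h2).trans (le_of_eq ?_)
  rw [ENNReal.ofReal_mul (by positivity), ENNReal.ofReal_mul (by positivity)]
  simp

theorem eLpNorm_tentAverage_sub_le (h : DoublingWith ν C) (hε : 0 < ε) {u : Z → ℝ}
    (hu : Integrable u ν) :
    eLpNorm (tentAverage ν ε u - u) 1 ν ≤ 2 * C * scaleOscillation ν u ε := by
  rw [eLpNorm_one_eq_lintegral_enorm, scaleOscillation, ← lintegral_const_mul' _ _ (by finiteness)]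
  exact lintegral_mono fun x => h.enorm_tentAverage_sub_le hε hu x

theorem lipschitzOnWith_tentAverage (h : DoublingWith ν C) (hε : 0 < ε) {u : Z → ℝ}
    (hu : Integrable u ν) (z : Z) :
    LipschitzOnWith ((2 * C ^ 3 + 4 * C ^ 6) / ε.toNNReal *
      ((ballOscillation ν u z (2 * ε)).toNNReal / (ν (ball z (2 * ε))).toNNReal))
      (tentAverage ν ε u) (ball z ε) := by
  refine LipschitzOnWith.of_dist_le_mul fun x hx x' hx' => ?_
  have := h.abs_tentAverage_sub_le hε hu hx hx'
  rw [Real.dist_eq]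
  simpa [hε.le, Measure.real, ENNReal.toReal] using this

/-- The sum over the net of local Lipschitz constants times indicators of the balls is an upper
gradient. On integration, the measure in the denominator of each constant absorbs that of the ball.
-/
theorem upperGradientEnergy_tentAverage_le (h : DoublingWith ν C) (hε : 0 < ε) {u : Z → ℝ}
    (hu : Integrable u ν) {S : Set Z} (hS : IsNet ε S) :
    upperGradientEnergy ν (tentAverage ν ε u) ≤
      ((2 * C ^ 3 + 4 * C ^ 6) / ε.toNNReal : ℝ≥0) *
        ∑' z : S, ballOscillation ν u z (2 * ε) := by
  have hSc : Countable S := (h.countable_of_separated hε hS.separated).to_subtype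
  set A : ℝ≥0 := (2 * C ^ 3 + 4 * C ^ 6) / ε.toNNReal
  set L : S → ℝ≥0 := fun z =>
    A * ((ballOscillation ν u z (2 * ε)).toNNReal / (ν (ball (z : Z) (2 * ε))).toNNReal) with hL
  set g : Z → ℝ≥0∞ := fun x => ∑' z : S, (ball (z : Z) ε).indicator (fun _ => (L z : ℝ≥0∞)) x
    with hg
  have hgm : ∀ z : S, Measurable ((ball (z : Z) ε).indicator fun _ => (L z : ℝ≥0∞)) :=
    fun z => measurable_const.indicator measurableSet_ball
  have hug : IsUpperGradient g (tentAverage ν ε u) := by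
    refine isUpperGradient_of_lipschitzOnWith (Measurable.tsum hgm)
      (fun z : S => ball (z : Z) ε) L (fun z => isOpen_ball) (fun x => ?_)
      (fun z => h.lipschitzOnWith_tentAverage hε hu z) (fun z x hx => ?_)
    · obtain ⟨z, hz, hd⟩ := hS.cover x
      exact ⟨⟨z, hz⟩, hd⟩
    · refine le_trans (le_of_eq ?_) (ENNReal.le_tsum z)
      rw [indicator_of_mem hx]
  refine (iInf₂_le g hug).trans ?_
  rw [hg, lintegral_tsum fun z => (hgm z).aemeasurable, ← ENNReal.tsum_mul_left]
  refine ENNReal.tsum_le_tsum fun z => ?_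
  rw [lintegral_indicator_const measurableSet_ball]
  have hV0 : ν (ball (z : Z) (2 * ε)) ≠ 0 := (h.pos _ _ (by positivity)).ne'
  have hVt : ν (ball (z : Z) (2 * ε)) ≠ ∞ := (h.finite _ _).ne
  calc (L z : ℝ≥0∞) * ν (ball (z : Z) ε) ≤ L z * ν (ball (z : Z) (2 * ε)) := by
        gcongr; linarith
    _ = A * ((ballOscillation ν u z (2 * ε)).toNNReal / ν (ball (z : Z) (2 * ε)) *
          ν (ball (z : Z) (2 * ε))) := by
        simp only [hL]
        rw [ENNReal.coe_mul, ENNReal.coe_div (ENNReal.toNNReal_ne_zero.2 ⟨hV0, hVt⟩),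
          ENNReal.coe_toNNReal hVt, mul_assoc]
    _ ≤ A * ballOscillation ν u z (2 * ε) := by
        rw [ENNReal.div_mul_cancel hV0 hVt]
        gcongr
        exact ENNReal.coe_toNNReal_le_self

/-- With exponent 1 the net sum supplies a factor `ε` that exactly cancels the `1/ε` of the
Lipschitz constants. -/
theorem johnNirenbergSpace_one_subset_BVSpace (h : DoublingWith ν C) {R τ : ℝ} (hR : 0 < R)
    (hτ : 1 ≤ τ) : JohnNirenbergSpace ν R τ 1 ⊆ BVSpace ν := by
  intro u hu
  obtain ⟨hL, hJ⟩ := ENNReal.add_lt_top.1 hu.2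
  have hmem : MemLp u 1 ν := ⟨hu.1, hL⟩
  have hint : Integrable u ν := memLp_one_iff_integrable.1 hmem
  refine ⟨hmem, ?_⟩
  have hτ0 : 0 < τ := by linarith
  set J := johnNirenbergEnergy ν R τ 1 u
  set N : ℝ≥0∞ := ((⌊C ^ 5⌋₊ + 1 : ℕ) : ℝ≥0∞) with hN
  have hNt : N < ∞ := by rw [hN]; finiteness
  -- Starting at `R / 2` keeps `2 * ε n ≤ R`, as admissibility requires.
  let ε : ℕ → ℝ := fun n => R / 2 / (n + 1)
  have hε : ∀ n, 0 < ε n := fun n => by positivity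
  have hεR : ∀ n, 2 * ε n ≤ R := fun n => by
    have : ε n ≤ R / 2 := div_le_self (by positivity) (by linarith [Nat.cast_nonneg (α := ℝ) n])
    linarith
  have hε0 : Tendsto ε atTop (𝓝 0) := by
    have := tendsto_one_div_add_atTop_nhds_zero_nat (𝕜 := ℝ).const_mul (R / 2)
    simpa [ε, div_eq_mul_inv] using this
  have hconv : Tendsto (fun n => eLpNorm (tentAverage ν (ε n) u - u) 1 ν) atTop (𝓝 0) := by
    have hlim : Tendsto (fun n => 2 * C * (2 * C ^ 2 * (N *
        (ENNReal.ofReal ((2 * ε n / τ) ^ (1 : ℝ)) * J)))) atTop (𝓝 0) := by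
      have h1 : Tendsto (fun n => ENNReal.ofReal ((2 * ε n / τ) ^ (1 : ℝ))) atTop (𝓝 0) := by
        simp_rw [Real.rpow_one]
        have := ENNReal.tendsto_ofReal ((hε0.const_mul 2).div_const τ)
        simpa using this
      have h2 := ENNReal.Tendsto.mul_const h1 (Or.inr hJ.ne)
      have h3 := ENNReal.Tendsto.const_mul h2 (Or.inr hNt.ne)
      have h4 := ENNReal.Tendsto.const_mul h3 (a := 2 * (C : ℝ≥0∞) ^ 2) (Or.inr (by finiteness))
      have h5 := ENNReal.Tendsto.const_mul h4 (a := 2 * (C : ℝ≥0∞)) (Or.inr (by finiteness))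
      simpa using h5
    refine tendsto_of_tendsto_of_tendsto_of_le_of_le tendsto_const_nhds hlim
      (fun _ => zero_le) fun n => ?_
    refine (h.eLpNorm_tentAverage_sub_le (hε n) hint).trans ?_
    gcongr
    exact h.scaleOscillation_le_johnNirenbergEnergy hτ (hε n) (hεR n)
  have hlip : ∀ n, LocallyLipschitz (tentAverage ν (ε n) u) := fun n x =>
    ⟨_, ball x (ε n), ball_mem_nhds x (hε n), h.lipschitzOnWith_tentAverage (hε n) hint x⟩
  set A : ℝ≥0 := 2 * C ^ 3 + 4 * C ^ 6 with hA
  have hen : ∀ n, upperGradientEnergy ν (tentAverage ν (ε n) u) ≤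
      A * (N * (ENNReal.ofReal (2 / τ) * J)) := by
    intro n
    obtain ⟨S, hS⟩ := exists_isNet (Z := Z) (hε n)
    have hεn : ENNReal.ofReal (ε n) ≠ 0 := by simpa using hε n
    calc upperGradientEnergy ν (tentAverage ν (ε n) u)
        ≤ (A / (ε n).toNNReal : ℝ≥0) *
            (N * (ENNReal.ofReal ((2 * ε n / τ) ^ (1 : ℝ)) * J)) := by
          refine (h.upperGradientEnergy_tentAverage_le (hε n) hint hS).trans ?_
          gcongr
          exact h.tsum_net_ballOscillation_le hτ (hε n) (hεR n) hS
      _ = A * (N * (ENNReal.ofReal (2 / τ) * J)) *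
            ((ENNReal.ofReal (ε n))⁻¹ * ENNReal.ofReal (ε n)) := by
          rw [ENNReal.coe_div (by simpa using hε n), Real.rpow_one, mul_div_right_comm,
            ENNReal.ofReal_mul (by positivity), div_eq_mul_inv]
          change _ * (ENNReal.ofReal (ε n))⁻¹ * _ = _
          ring
      _ = _ := by rw [ENNReal.inv_mul_cancel hεn ENNReal.ofReal_ne_top, mul_one]
  calc totalVariation ν u
      ≤ liminf (fun n => upperGradientEnergy ν (tentAverage ν (ε n) u)) atTop :=
        iInf_le_of_le _ (iInf₂_le hlip hconv)
    _ ≤ A * (N * (ENNReal.ofReal (2 / τ) * J)) :=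
        (liminf_le_liminf (Eventually.of_forall hen)).trans_eq (liminf_const _)
    _ < ∞ := ENNReal.mul_lt_top (by finiteness)
        (ENNReal.mul_lt_top hNt (ENNReal.mul_lt_top (by finiteness) hJ))

end DoublingWith

/-! ### The ultrametric space of binary sequences with the coin measure -/

/-- The space of binary sequences, with the distance `2⁻ⁿ` for sequences first differing
at index `n`. -/
def BinarySequence : Type := ℕ → Bool

namespace BinarySequence

noncomputable instance : MetricSpace BinarySequence :=
  PiNat.metricSpaceOfDiscreteUniformity (E := fun _ => Bool) fun _ => rfl

instance : MeasurableSpace BinarySequence := MeasurableSpace.pi (X := fun _ : ℕ => Bool)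

instance : BorelSpace BinarySequence := Pi.borelSpace (X := fun _ : ℕ => Bool)

theorem dist_le_pow_iff {x y : BinarySequence} {n : ℕ} :
    dist x y ≤ (1 / 2) ^ n ↔ ∀ i < n, x i = y i :=
  (PiNat.mem_cylinder_iff_dist_le (E := fun _ => Bool)).symm.trans PiNat.mem_cylinder_iff

theorem dist_lt_pow_iff {x y : BinarySequence} {n : ℕ} :
    dist x y < (1 / 2) ^ n ↔ ∀ i ≤ n, x i = y i := by
  refine ⟨fun h i hi => PiNat.apply_eq_of_dist_lt (E := fun _ => Bool) h hi, fun h => ?_⟩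
  refine (dist_le_pow_iff.2 fun i hi => h i (Nat.lt_succ_iff.1 hi)).trans_lt ?_
  exact pow_lt_pow_right_of_lt_one₀ (by norm_num) (by norm_num) n.lt_succ_self

theorem dist_le_max (x y z : BinarySequence) : dist x z ≤ max (dist x y) (dist y z) :=
  PiNat.dist_triangle_nonarch (E := fun _ => Bool) x y z

theorem dist_le_one (x y : BinarySequence) : dist x y ≤ 1 := by
  simpa using (dist_le_pow_iff (x := x) (y := y) (n := 0)).2 (by simp)

theorem exists_dist_eq {x y : BinarySequence} (h : x ≠ y) : ∃ n, dist x y = (1 / 2) ^ n :=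
  ⟨_, PiNat.dist_eq_of_ne (E := fun _ => Bool) h⟩

theorem isBounded_univ : Bornology.IsBounded (univ : Set BinarySequence) :=
  isBounded_iff.2 ⟨1, fun x _ y _ => dist_le_one x y⟩

/-- The uniform measure on `Bool`. -/
noncomputable def coin : Measure Bool := (PMF.uniformOfFintype Bool).toMeasure

instance : IsProbabilityMeasure coin := by unfold coin; infer_instance

theorem coin_singleton (b : Bool) : coin {b} = 1 / 2 := by
  rw [coin, PMF.toMeasure_apply_singleton _ _ (measurableSet_singleton b)]
  simp

theorem map_not_coin : coin.map not = coin := by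
  refine Measure.ext_of_singleton fun b => ?_
  rw [Measure.map_apply (measurable_from_top) (measurableSet_singleton b),
    show not ⁻¹' {b} = {!b} by ext c; simp [Bool.not_eq_eq_eq_not], coin_singleton, coin_singleton]

/-- The uniform product measure. -/
noncomputable def uniform : Measure BinarySequence := Measure.infinitePi fun _ : ℕ => coin

instance : IsProbabilityMeasure uniform := by
  unfold uniform
  exact inferInstanceAs (IsProbabilityMeasure (Measure.infinitePi fun _ : ℕ => coin))

theorem uniform_cylinder (x : BinarySequence) (n : ℕ) :
    uniform {y | ∀ i < n, y i = x i} = (1 / 2) ^ n := by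
  have : {y : BinarySequence | ∀ i < n, y i = x i} =
      Set.pi (Finset.range n : Set ℕ) fun i => {x i} := by
    ext y; rw [Finset.coe_range]; exact Iff.rfl
  rw [this, uniform]
  refine (Measure.infinitePi_pi (μ := fun _ : ℕ => coin)
    fun i _ => measurableSet_singleton (x i)).trans ?_
  simp [coin_singleton]

theorem isDoubling_uniform : IsDoubling uniform := by
  refine ⟨2, fun z r hr => ?_⟩
  have hpos : ∀ s : ℝ, 0 < s → 0 < uniform (ball z s) := by
    intro s hs
    obtain ⟨n, hn⟩ := exists_pow_lt_of_lt_one hs (show (1 / 2 : ℝ) < 1 by norm_num)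
    have hsub : {y : BinarySequence | ∀ i < n, y i = z i} ⊆ ball z s := fun y hy =>
      (dist_le_pow_iff.2 hy).trans_lt hn
    refine lt_of_lt_of_le ?_ (measure_mono hsub)
    rw [uniform_cylinder]
    exact ENNReal.pow_pos (by norm_num) n
  refine ⟨hpos _ (by positivity), ?_, measure_lt_top _ _⟩
  rcases le_or_gt r 1 with h1 | h1
  -- For `2^(-n-1) < r ≤ 2^(-n)`, the ball of radius `2r` lies in the cylinder of length `n`, and
  -- that of radius `r` contains the cylinder of length `n + 1`, of half the measure.
  · obtain ⟨n, hn1, hn2⟩ := exists_nat_pow_near_of_lt_one hr h1 (show (0 : ℝ) < 1 / 2 by norm_num)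
      (by norm_num)
    calc uniform (ball z (2 * r)) ≤ uniform {y | ∀ i < n, y i = z i} := by
          refine measure_mono fun y hy i hi => ?_
          obtain ⟨m, rfl⟩ : ∃ m, n = m + 1 := ⟨n - 1, by omega⟩
          refine dist_lt_pow_iff.1 (lt_of_lt_of_le (mem_ball.1 hy) ?_) i (Nat.lt_succ_iff.1 hi)
          rw [pow_succ] at hn2
          linarith
      _ = (2 : ℝ≥0) * uniform {y | ∀ i < n + 1, y i = z i} := by
          rw [uniform_cylinder, uniform_cylinder, pow_succ', ← mul_assoc, ENNReal.coe_ofNat,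
            one_div, ENNReal.mul_inv_cancel two_ne_zero ENNReal.ofNat_ne_top, one_mul]
      _ ≤ (2 : ℝ≥0) * uniform (ball z r) := by
          gcongr
          exact fun y hy => (dist_le_pow_iff.2 hy).trans_lt hn1
  · have : ball z r = univ := eq_univ_of_forall fun y => (dist_le_one y z).trans_lt h1
    rw [this, measure_univ, mul_one, ENNReal.coe_ofNat]
    exact prob_le_one.trans one_le_two

/-- The involution changing the `m`-th entry. -/
def flip (m : ℕ) (x : BinarySequence) : BinarySequence :=
  fun i => (if i = m then not else id) (x i)

theorem flip_apply_self (m : ℕ) (x : BinarySequence) : flip m x m = !x m := by simp [flip]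

theorem flip_apply_of_ne {m i : ℕ} (h : i ≠ m) (x : BinarySequence) : flip m x i = x i := by
  simp [flip, h]

theorem measurePreserving_flip (m : ℕ) : MeasurePreserving (flip m) uniform uniform := by
  have hm : ∀ i : ℕ, Measurable (if i = m then not else id : Bool → Bool) :=
    fun _ => measurable_from_top
  refine ⟨measurable_pi_lambda _ fun i => (hm i).comp (measurable_pi_apply i), ?_⟩
  refine (Measure.infinitePi_map_pi (fun _ : ℕ => coin) hm).trans ?_
  unfold uniform
  congr 1
  funext i
  split_ifs
  · exact map_not_coin
  · exact Measure.map_id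

theorem dist_flip_le (m : ℕ) (x : BinarySequence) : dist (flip m x) x ≤ (1 / 2) ^ m :=
  dist_le_pow_iff.2 fun _ hi => flip_apply_of_ne hi.ne x

/-- The flip moves points by less than `r`, and in an ultrametric such a move cannot leave or enter
a ball of radius `r`. -/
theorem flip_preimage_ball {m : ℕ} {r : ℝ} (h : (1 / 2) ^ m < r) (x : BinarySequence) :
    flip m ⁻¹' ball x r = ball x r := by
  ext y
  have hy := (dist_flip_le m y).trans_lt h
  refine ⟨fun hf => ?_, fun hf => (dist_le_max _ y x).trans_lt (max_lt hy hf)⟩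
  rw [dist_comm] at hy
  exact (dist_le_max y (flip m y) x).trans_lt (max_lt hy hf)

/-! ### Rademacher series and lower bounds for their energies -/

/-- The value `±1` of a bit. -/
def sign (b : Bool) : ℝ := if b then 1 else -1

theorem abs_sign (b : Bool) : |sign b| = 1 := by cases b <;> simp [sign]

theorem sign_not (b : Bool) : sign (!b) = -sign b := by cases b <;> simp [sign]

/-- The series `∑ b k r_{n k}` of Rademacher functions. -/
noncomputable def rademacherSeries (b : ℕ → ℝ) (n : ℕ → ℕ) (x : BinarySequence) : ℝ :=
  ∑' k, b k * sign (x (n k))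

section RademacherSeries

variable {b : ℕ → ℝ} {n : ℕ → ℕ}

theorem summable_rademacherSeries (hb : Summable b) (hb0 : ∀ k, 0 ≤ b k) (x : BinarySequence) :
    Summable fun k => b k * sign (x (n k)) :=
  Summable.of_norm_bounded hb fun k => by
    rw [norm_mul, Real.norm_eq_abs, Real.norm_eq_abs, abs_sign, mul_one, abs_of_nonneg (hb0 k)]

theorem measurable_rademacherSeries : Measurable (rademacherSeries b n) :=
  Measurable.tsum fun k => ((measurable_from_top (f := sign)).comp
    (measurable_pi_apply (X := fun _ => Bool) (n k))).const_mul (b k)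

theorem abs_rademacherSeries_le (hb : Summable b) (hb0 : ∀ k, 0 ≤ b k) (x : BinarySequence) :
    |rademacherSeries b n x| ≤ ∑' k, b k := by
  rw [← Real.norm_eq_abs, rademacherSeries]
  exact tsum_of_norm_bounded hb.hasSum fun k => by
    rw [norm_mul, Real.norm_eq_abs, Real.norm_eq_abs, abs_sign, mul_one, abs_of_nonneg (hb0 k)]

theorem memLp_rademacherSeries (hb : Summable b) (hb0 : ∀ k, 0 ≤ b k) :
    MemLp (rademacherSeries b n) 1 uniform :=
  MemLp.of_bound measurable_rademacherSeries.aestronglyMeasurable _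
    (Eventually.of_forall (abs_rademacherSeries_le hb hb0))

theorem abs_rademacherSeries_flip_sub (hb : Summable b) (hb0 : ∀ k, 0 ≤ b k)
    (hn : Function.Injective n) (k : ℕ) (x : BinarySequence) :
    |rademacherSeries b n (flip (n k) x) - rademacherSeries b n x| = 2 * b k := by
  unfold rademacherSeries
  rw [← (summable_rademacherSeries hb hb0 _).tsum_sub (summable_rademacherSeries hb hb0 _),
    tsum_eq_single k fun j hj => by rw [flip_apply_of_ne (hn.ne hj), sub_self],
    flip_apply_self, sign_not, show b k * -sign (x (n k)) - b k * sign (x (n k)) =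
      -(2 * b k * sign (x (n k))) by ring, abs_neg, abs_mul, abs_sign, mul_one,
    abs_of_nonneg (by linarith [hb0 k])]

/-- By flip invariance, twice the right side is the integral of `|u ∘ flip - c| + |u - c|`, which
dominates `|u ∘ flip - u| = 2 * b k`. -/
theorem le_lintegral_rademacherSeries_sub (hb : Summable b) (hb0 : ∀ k, 0 ≤ b k)
    (hn : Function.Injective n) {k : ℕ} {r : ℝ} (hr : (1 / 2) ^ n k < r) (x : BinarySequence)
    (c : ℝ) :
    ENNReal.ofReal (b k) * uniform (ball x r) ≤
      ∫⁻ y in ball x r, ‖rademacherSeries b n y - c‖ₑ ∂uniform := by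
  set u := rademacherSeries b n with hu
  have hum : Measurable u := measurable_rademacherSeries
  have hf : Measurable fun y => ‖u y - c‖ₑ := (hum.sub_const c).enorm
  have hflip : ∫⁻ y in ball x r, ‖u (flip (n k) y) - c‖ₑ ∂uniform =
      ∫⁻ y in ball x r, ‖u y - c‖ₑ ∂uniform := by
    have := (measurePreserving_flip (n k)).setLIntegral_comp_preimage
      (measurableSet_ball (x := x) (ε := r)) hf
    rwa [flip_preimage_ball hr] at this
  have h2 : 2 * (ENNReal.ofReal (b k) * uniform (ball x r)) ≤
      2 * ∫⁻ y in ball x r, ‖u y - c‖ₑ ∂uniform := by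
    calc 2 * (ENNReal.ofReal (b k) * uniform (ball x r))
        = ∫⁻ y in ball x r, ‖u (flip (n k) y) - u y‖ₑ ∂uniform := by
          simp_rw [← ofReal_norm, Real.norm_eq_abs, hu, abs_rademacherSeries_flip_sub hb hb0 hn]
          rw [setLIntegral_const, ENNReal.ofReal_mul zero_le_two, mul_assoc, ENNReal.ofReal_ofNat]
      _ ≤ ∫⁻ y in ball x r, (‖u (flip (n k) y) - c‖ₑ + ‖u y - c‖ₑ) ∂uniform := by
          refine lintegral_mono fun y => ?_
          rw [← sub_sub_sub_cancel_right _ _ c]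
          exact enorm_sub_le
      _ = _ := by rw [lintegral_add_right _ hf, hflip, two_mul]
  exact (ENNReal.mul_le_mul_iff_right two_ne_zero ENNReal.ofNat_ne_top).1 h2

theorem le_scaleOscillation_rademacherSeries (hb : Summable b) (hb0 : ∀ k, 0 ≤ b k)
    (hn : Function.Injective n) {k : ℕ} {t : ℝ} (ht : (1 / 2) ^ n k < t) :
    ENNReal.ofReal (b k) ≤ scaleOscillation uniform (rademacherSeries b n) t := by
  obtain ⟨C, hC⟩ := isDoubling_uniform.exists_doublingWith
  have ht0 : 0 < t := lt_trans (by positivity) ht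
  calc ENNReal.ofReal (b k) = ∫⁻ _, ENNReal.ofReal (b k) ∂uniform := by simp
    _ ≤ _ := lintegral_mono fun x => by
        rw [setLAverage_eq, ENNReal.le_div_iff_mul_le (Or.inl (hC.pos x t ht0).ne')
          (Or.inl (hC.finite x t).ne)]
        exact le_lintegral_rademacherSeries_sub hb hb0 hn ht x _

/-- The oscillation is at least `b k` at all scales between `2^(-n k)` and `R`, an interval of
logarithmic length `log R + n k * log 2`. -/
theorem le_besovEnergy_rademacherSeries (hb : Summable b) (hb0 : ∀ k, 0 ≤ b k)
    (hn : Function.Injective n) {k : ℕ} {R : ℝ} (hR : (1 / 2) ^ n k < R) :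
    ENNReal.ofReal (b k * (Real.log R + n k * Real.log 2)) ≤
      besovEnergy uniform R 0 (rademacherSeries b n) := by
  set δ : ℝ := (1 / 2) ^ n k with hδ
  have hδ0 : 0 < δ := by positivity
  have hint : ENNReal.ofReal (Real.log R + n k * Real.log 2) =
      ∫⁻ t in Ioo δ R, ENNReal.ofReal t⁻¹ := by
    have h1 : ∫ t in δ..R, t⁻¹ = Real.log R + n k * Real.log 2 := by
      rw [integral_inv_of_pos hδ0 (hδ0.trans hR), Real.log_div (hδ0.trans hR).ne' hδ0.ne', hδ,
        Real.log_pow, one_div, Real.log_inv]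
      ring
    have h2 : IntegrableOn (fun t : ℝ => t⁻¹) (Ioc δ R) :=
      (intervalIntegral.intervalIntegrable_inv (fun t ht => by
        rw [uIcc_of_le hR.le] at ht
        exact (hδ0.trans_le ht.1).ne') continuousOn_id).1
    rw [← h1, intervalIntegral.integral_of_le hR.le, restrict_Ioo_eq_restrict_Ioc,
      ofReal_integral_eq_lintegral_ofReal h2]
    filter_upwards [ae_restrict_mem measurableSet_Ioc] with t ht
    exact inv_nonneg.2 (hδ0.trans ht.1).le
  calc ENNReal.ofReal (b k * (Real.log R + n k * Real.log 2))
      = ∫⁻ t in Ioo δ R, ENNReal.ofReal (b k) * ENNReal.ofReal t⁻¹ := by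
        rw [ENNReal.ofReal_mul (hb0 k), hint, lintegral_const_mul' _ _ ENNReal.ofReal_ne_top]
    _ ≤ ∫⁻ t in Ioo δ R, scaleOscillation uniform (rademacherSeries b n) t /
          ENNReal.ofReal (t ^ (1 + (0 : ℝ))) := by
        refine setLIntegral_mono' measurableSet_Ioo fun t ht => ?_
        have ht0 := hδ0.trans ht.1
        rw [add_zero, Real.rpow_one, ENNReal.ofReal_inv_of_pos ht0, div_eq_mul_inv]
        gcongr
        exact le_scaleOscillation_rademacherSeries hb hb0 hn ht.1
    _ ≤ _ := lintegral_mono_set (Ioo_subset_Ioo_left hδ0.le)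

theorem le_johnNirenbergEnergy_rademacherSeries (hb : Summable b) (hb0 : ∀ k, 0 ≤ b k)
    (hn : Function.Injective n) {k : ℕ} {R τ θ t : ℝ} (hτ : 1 ≤ τ) (ht : (1 / 2) ^ n k < t)
    (htR : t ≤ R) :
    ENNReal.ofReal (b k) ≤ ENNReal.ofReal ((t / τ) ^ θ) *
      johnNirenbergEnergy uniform R τ θ (rademacherSeries b n) := by
  obtain ⟨C, hC⟩ := isDoubling_uniform.exists_doublingWith
  have ht0 : 0 < t := lt_trans (by positivity) ht
  obtain ⟨S, hS⟩ := exists_isNet (Z := BinarySequence) ht0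
  have hSc : Countable S := (hC.countable_of_separated ht0 hS.separated).to_subtype
  -- In an ultrametric the net balls of radius `t` themselves partition the space, so no colouring
  -- is needed.
  have hdisj : S.Pairwise fun x y => Disjoint (ball x t) (ball y t) := by
    intro x hx y hy hxy
    refine disjoint_left.2 fun w hwx hwy => ?_
    have := (dist_le_max x w y).trans_lt (max_lt (mem_ball'.1 hwx) (mem_ball.1 hwy))
    exact this.not_ge (hS.separated hx hy hxy)
  calc ENNReal.ofReal (b k)
      = ENNReal.ofReal (b k) * uniform (⋃ z : S, ball (z : BinarySequence) t) := by
        rw [show ⋃ z : S, ball (z : BinarySequence) t = univ from eq_univ_of_forall fun x => by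
          obtain ⟨z, hz, hd⟩ := hS.cover x
          exact mem_iUnion.2 ⟨⟨z, hz⟩, hd⟩, measure_univ, mul_one]
    _ ≤ ENNReal.ofReal (b k) * ∑' z : S, uniform (ball (z : BinarySequence) t) := by
        gcongr; exact measure_iUnion_le _
    _ = ∑' z : S, ENNReal.ofReal (b k) * uniform (ball (z : BinarySequence) t) :=
        ENNReal.tsum_mul_left.symm
    _ ≤ ∑' z : S, ballOscillation uniform (rademacherSeries b n) z t :=
        ENNReal.tsum_le_tsum fun z => le_lintegral_rademacherSeries_sub hb hb0 hn ht _ _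
    _ ≤ _ := by
        rw [ENNReal.tsum_eq_iSup_sum]
        refine iSup_le fun s => ?_
        refine (Finset.sum_map s (Function.Embedding.subtype _)
          fun z => ballOscillation uniform (rademacherSeries b n) z t).symm.trans_le ?_
        refine sum_ballOscillation_le_johnNirenbergEnergy hτ ht0 htR _ (hdisj.mono ?_)
        intro x hx
        obtain ⟨y, -, rfl⟩ := Finset.mem_map.1 (Finset.mem_coe.1 hx)
        exact y.2

end RademacherSeries

end BinarySequence

/-! ### Hölder functions -/

section Holder

variable {Z : Type*} [MetricSpace Z] [MeasurableSpace Z] [BorelSpace Z] {ν : Measure Z} {C : ℝ≥0}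

/-- By convexity, the mean of `u` lies within `M` of each value `u y`. -/
theorem ballOscillation_le_of_forall_abs_sub_le {u : Z → ℝ} {z : Z} {r M : ℝ}
    (hν0 : ν (ball z r) ≠ 0) (hνt : ν (ball z r) ≠ ∞) (hu : IntegrableOn u (ball z r) ν)
    (hM : ∀ x ∈ ball z r, ∀ y ∈ ball z r, |u x - u y| ≤ M) :
    ballOscillation ν u z r ≤ ENNReal.ofReal M * ν (ball z r) := by
  rw [← setLIntegral_const]
  refine setLIntegral_mono' measurableSet_ball fun y hy => ?_
  have hav : ⨍ w in ball z r, u w ∂ν ∈ closedBall (u y) M :=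
    (convex_closedBall (u y) M).set_average_mem isClosed_closedBall hν0 hνt
      ((ae_restrict_mem measurableSet_ball).mono fun x hx => by
        rw [mem_closedBall, Real.dist_eq]; exact hM x hx y hy) hu
  rw [mem_closedBall', Real.dist_eq] at hav
  rw [← ofReal_norm, Real.norm_eq_abs]
  exact ENNReal.ofReal_le_ofReal hav

/-- An integrable `θ`-Hölder function on a space of finite measure lies in the fractional
John–Nirenberg space of exponent `θ`. -/
theorem DoublingWith.holder_mem_johnNirenbergSpace [IsFiniteMeasure ν] (h : DoublingWith ν C)
    {u : Z → ℝ} (hu : MemLp u 1 ν) {K θ : ℝ} (hK : 0 ≤ K) (hθ : 0 ≤ θ)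
    (huK : ∀ x y, |u x - u y| ≤ K * dist x y ^ θ) {R τ : ℝ} (hτ : 1 ≤ τ) :
    u ∈ JohnNirenbergSpace ν R τ θ := by
  refine ⟨hu.1, ENNReal.add_lt_top.2 ⟨hu.2, ?_⟩⟩
  have hτ0 : 0 < τ := by linarith
  have hint := memLp_one_iff_integrable.1 hu
  set A : ℝ≥0∞ := ENNReal.ofReal (K * (2 * τ) ^ θ)
  refine lt_of_le_of_lt (b := A * ν univ) (iSup₂_le fun 𝓑 h𝓑 => ?_)
    (ENNReal.mul_lt_top ENNReal.ofReal_lt_top (measure_lt_top _ _))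
  rw [ENNReal.tsum_eq_iSup_sum]
  refine iSup_le fun T => ?_
  calc ∑ B ∈ T, ballOscillation ν u B.1.1 (τ * B.1.2) / ENNReal.ofReal (B.1.2 ^ θ)
      ≤ ∑ B ∈ T, A * ν (ball B.1.1 (τ * B.1.2)) := by
        refine Finset.sum_le_sum fun B _ => ENNReal.div_le_of_le_mul ?_
        have hr := (h𝓑.1 B.1 B.2).1
        refine (ballOscillation_le_of_forall_abs_sub_le (M := K * (2 * τ) ^ θ * B.1.2 ^ θ)
          (h.pos _ _ (by positivity)).ne' (h.finite _ _).ne hint.integrableOn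
          fun x hx y hy => (huK x y).trans ?_).trans (le_of_eq ?_)
        · rw [mul_assoc, ← Real.mul_rpow (by positivity) hr.le]
          have : dist x y ≤ 2 * τ * B.1.2 := by
            have := dist_triangle_right x y B.1.1
            linarith [mem_ball.1 hx, mem_ball.1 hy]
          gcongr
        · rw [ENNReal.ofReal_mul (by positivity)]; ring
    _ = A * ν (⋃ B ∈ T, ball B.1.1 (τ * B.1.2)) := by
        rw [measure_biUnion_finset _ fun _ _ => measurableSet_ball, Finset.mul_sum]
        exact fun i _ j _ hij => h𝓑.2 i.2 j.2 fun e => hij (Subtype.ext e)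
    _ ≤ A * ν univ := by gcongr; exact subset_univ _

end Holder

/-! ### Examples for strictness -/

namespace BinarySequence

/-- The series `∑ 2^{-αk} r_k` is `α`-Hölder continuous. -/
theorem holder_rademacherSeries {α : ℝ} (hα : 0 < α) :
    ∃ K, 0 ≤ K ∧ ∀ x y, |rademacherSeries (fun k => ((1 / 2 : ℝ) ^ α) ^ k) id x -
      rademacherSeries (fun k => ((1 / 2 : ℝ) ^ α) ^ k) id y| ≤ K * dist x y ^ α := by
  set q : ℝ := (1 / 2 : ℝ) ^ α with hq
  have hq0 : 0 < q := by positivity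
  have hq1 : q < 1 := Real.rpow_lt_one (by norm_num) (by norm_num) hα
  have hb : Summable fun k : ℕ => q ^ k := summable_geometric_of_lt_one hq0.le hq1
  have hb0 : ∀ k : ℕ, 0 ≤ q ^ k := fun k => by positivity
  have h1q : 0 < 1 - q := by linarith
  refine ⟨2 * (1 - q)⁻¹, by positivity, fun x y => ?_⟩
  rcases eq_or_ne x y with rfl | hxy
  · simp only [sub_self, abs_zero]; positivity
  obtain ⟨N, hN⟩ := exists_dist_eq hxy
  have heq := dist_le_pow_iff.1 hN.le
  unfold rademacherSeries
  rw [← (summable_rademacherSeries hb hb0 _).tsum_sub (summable_rademacherSeries hb hb0 _)]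
  set f : ℕ → ℝ := fun k => q ^ k * sign (x (id k)) - q ^ k * sign (y (id k)) with hf
  have hfs : Summable f :=
    (summable_rademacherSeries hb hb0 _).sub (summable_rademacherSeries hb hb0 _)
  -- The sequences agree below `N`, so only a geometric tail of size `q ^ N = dist x y ^ α`
  -- survives.
  have hzero : ∑ k ∈ Finset.range N, f k = 0 := Finset.sum_eq_zero fun k hk => by
    simp only [hf, id, heq k (Finset.mem_range.1 hk), sub_self]
  have htail : ∑' k, f k = ∑' k, f (k + N) := by
    rw [← hfs.sum_add_tsum_nat_add N, hzero, zero_add]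
  rw [htail, hN, ← Real.norm_eq_abs, ← Real.rpow_natCast, ← Real.rpow_mul (by norm_num),
    mul_comm (N : ℝ), Real.rpow_mul (by norm_num), Real.rpow_natCast, ← hq]
  have hg : HasSum (fun k => 2 * q ^ N * q ^ k) (2 * q ^ N * (1 - q)⁻¹) :=
    (hasSum_geometric_of_lt_one hq0.le hq1).mul_left _
  refine (tsum_of_norm_bounded hg fun k => ?_).trans_eq (by ring)
  have h1 : ‖f (k + N)‖ ≤ ‖q ^ (k + N) * sign (x (k + N))‖ + ‖q ^ (k + N) * sign (y (k + N))‖ :=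
    norm_sub_le _ _
  have hs : ∀ c : Bool, ‖q ^ (k + N) * sign c‖ = q ^ (k + N) := fun c => by
    rw [norm_mul, Real.norm_eq_abs, Real.norm_eq_abs, abs_sign, mul_one, abs_of_nonneg (hb0 _)]
  rw [hs, hs] at h1
  calc ‖f (k + N)‖ ≤ q ^ (k + N) + q ^ (k + N) := h1
    _ = _ := by ring

/-- For `0 < α < θ` the John–Nirenberg space of exponent `α` is larger than that of
exponent `θ`. -/
theorem exists_mem_johnNirenbergSpace_notMem {α θ R τ : ℝ} (hα : 0 < α) (hαθ : α < θ) (hR : 0 < R)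
    (hτ : 1 ≤ τ) : ∃ u ∈ JohnNirenbergSpace uniform R τ α, u ∉ JohnNirenbergSpace uniform R τ θ := by
  obtain ⟨C, hC⟩ := isDoubling_uniform.exists_doublingWith
  have hτ0 : 0 < τ := by linarith
  set q : ℝ := (1 / 2 : ℝ) ^ α with hq
  have hq0 : 0 < q := by positivity
  have hq1 : q < 1 := Real.rpow_lt_one (by norm_num) (by norm_num) hα
  have hb : Summable fun k : ℕ => q ^ k := summable_geometric_of_lt_one hq0.le hq1
  have hb0 : ∀ k : ℕ, 0 ≤ q ^ k := fun k => by positivity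
  obtain ⟨K, hK, hKu⟩ := holder_rademacherSeries hα
  refine ⟨rademacherSeries (fun k => q ^ k) id, hC.holder_mem_johnNirenbergSpace
    (memLp_rademacherSeries hb hb0) hK hα.le hKu hτ, fun hu => ?_⟩
  have hJ := (ENNReal.add_lt_top.1 hu.2).2
  set J := johnNirenbergEnergy uniform R τ θ (rademacherSeries (fun k => q ^ k) id)
  set p : ℝ := (1 / 2 : ℝ) ^ θ with hp
  have hp0 : 0 < p := by positivity
  have hpq : 1 < q / p := by
    rw [one_lt_div hp0]
    exact Real.rpow_lt_rpow_of_exponent_gt (by norm_num) (by norm_num) hαθ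
  have hlarge := (tendsto_pow_atTop_atTop_of_one_lt hpq).eventually_gt_atTop
    ((2 / τ) ^ θ * J.toReal)
  have hsmall : ∀ᶠ k : ℕ in atTop, 2 * (1 / 2 : ℝ) ^ k < R := by
    have := (tendsto_pow_atTop_nhds_zero_of_lt_one (r := (1 / 2 : ℝ)) (by norm_num)
      (by norm_num)).const_mul 2
    rw [mul_zero] at this
    exact this.eventually_lt_const hR
  obtain ⟨k, hk1, hk2⟩ := (hlarge.and hsmall).exists
  have hk0 : (0 : ℝ) < (1 / 2) ^ k := by positivity
  -- The scale is `2 * (1/2)^k` because it must strictly exceed `(1/2)^k`. A finite energy would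
  -- bound `(q / p) ^ k` for all large `k`, although `q / p > 1`.
  have hle := le_johnNirenbergEnergy_rademacherSeries (θ := θ) hb hb0 Function.injective_id
    (k := k) hτ (show (1 / 2 : ℝ) ^ k < 2 * (1 / 2) ^ k by linarith) hk2.le
  change ENNReal.ofReal (q ^ k) ≤ _ * J at hle
  rw [← ENNReal.ofReal_toReal hJ.ne, ← ENNReal.ofReal_mul (by positivity),
    ENNReal.ofReal_le_ofReal_iff (by positivity)] at hle
  have hsplit : (2 * (1 / 2 : ℝ) ^ k / τ) ^ θ = (2 / τ) ^ θ * p ^ k := by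
    rw [mul_div_right_comm, Real.mul_rpow (by positivity) hk0.le, hp, ← Real.rpow_natCast,
      ← Real.rpow_natCast, ← Real.rpow_mul (by norm_num), ← Real.rpow_mul (by norm_num),
      mul_comm (k : ℝ)]
  rw [hsplit] at hle
  rw [div_pow, lt_div_iff₀ (by positivity)] at hk1
  linarith

/-- The coefficients `2^(-k)` are summable, yet placed at the sparse bits `4^k` they give `b k * n k
= 2^k`, which is unbounded. -/
theorem exists_mem_L1Space_notMem_besovSpace :
    ∃ u ∈ L1Space uniform, ∀ R : ℝ, 0 < R → u ∉ BesovSpace uniform R 0 := by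
  have hb : Summable fun k : ℕ => (1 / 2 : ℝ) ^ k := summable_geometric_two
  have hb0 : ∀ k : ℕ, 0 ≤ (1 / 2 : ℝ) ^ k := fun k => by positivity
  have hn : Function.Injective fun k : ℕ => 4 ^ k := Nat.pow_right_injective (by norm_num)
  refine ⟨rademacherSeries (fun k => (1 / 2) ^ k) (fun k => 4 ^ k),
    memLp_rademacherSeries hb hb0, fun R hR hu => ?_⟩
  have hE := (ENNReal.add_lt_top.1 hu.2).2
  set E := besovEnergy uniform R 0
    (rademacherSeries (fun k => (1 / 2) ^ k) (fun k => 4 ^ k)) with hEdef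
  have hlim : Tendsto (fun k : ℕ => (1 / 2 : ℝ) ^ k * (Real.log R + (4 ^ k : ℕ) * Real.log 2))
      atTop atTop := by
    have h1 : Tendsto (fun k : ℕ => (1 / 2 : ℝ) ^ k * Real.log R) atTop (𝓝 (0 * Real.log R)) :=
      (tendsto_pow_atTop_nhds_zero_of_lt_one (by norm_num) (by norm_num)).mul_const _
    have h2 : Tendsto (fun k : ℕ => (2 : ℝ) ^ k * Real.log 2) atTop atTop :=
      (tendsto_pow_atTop_atTop_of_one_lt one_lt_two).atTop_mul_const (Real.log_pos one_lt_two)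
    refine (h1.add_atTop h2).congr fun k => ?_
    have : (1 / 2 : ℝ) ^ k * 4 ^ k = 2 ^ k := by rw [← mul_pow]; norm_num
    push_cast
    rw [mul_add, ← mul_assoc _ _ (Real.log 2), this]
  have hsmall : ∀ᶠ k : ℕ in atTop, (1 / 2 : ℝ) ^ (4 ^ k) < R :=
    ((tendsto_pow_atTop_nhds_zero_of_lt_one (r := (1 / 2 : ℝ)) (by norm_num) (by norm_num)).comp
      (tendsto_pow_atTop_atTop_of_one_lt (r := 4) (by norm_num))).eventually_lt_const hR
  obtain ⟨k, hk1, hk2⟩ := ((hlim.eventually_gt_atTop E.toReal).and hsmall).exists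
  have hle := le_besovEnergy_rademacherSeries hb hb0 hn hk2
  rw [← hEdef, ENNReal.ofReal_le_iff_le_toReal hE.ne] at hle
  exact hk1.not_ge hle

end BinarySequence

/-! ### The theorem -/

theorem mainTheorem4 :
    (∀ (Z : Type*) [MetricSpace Z] [MeasurableSpace Z] [BorelSpace Z] (ν : Measure Z),
      IsDoubling ν → ∀ R τ θ : ℝ, 0 < R → 1 ≤ τ → 0 < θ → θ ≤ 1 →
        L1Space ν = JohnNirenbergSpace ν R τ 0 ∧
        BesovSpace ν R 0 ⊆ JohnNirenbergSpace ν R τ 0 ∧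
        JohnNirenbergSpace ν R τ θ ⊆ BesovSpace ν R 0 ∧
        JohnNirenbergSpace ν R τ 1 ⊆ JohnNirenbergSpace ν R τ θ ∧
        JohnNirenbergSpace ν R τ 1 ⊆ BVSpace ν ∧
        (Bornology.IsBounded (Set.univ : Set Z) →
          ∀ (K : ℝ≥0) (u : Z → ℝ), LipschitzWith K u → u ∈ BesovSpace ν R 0)) ∧
    (∃ (Z : Type) (_ : MetricSpace Z) (_ : MeasurableSpace Z) (_ : BorelSpace Z)
      (ν : Measure Z), IsDoubling ν ∧ Bornology.IsBounded (Set.univ : Set Z) ∧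
        ∀ R τ θ : ℝ, 0 < R → 1 ≤ τ → 0 < θ → θ ≤ 1 →
          BesovSpace ν R 0 ⊂ JohnNirenbergSpace ν R τ 0 ∧
          JohnNirenbergSpace ν R τ θ ⊂ BesovSpace ν R 0 ∧
          (θ < 1 → JohnNirenbergSpace ν R τ 1 ⊂ JohnNirenbergSpace ν R τ θ)) := by
  constructor
  · intro Z _ _ _ ν hν R τ θ hR hτ hθ hθ1
    obtain ⟨C, h⟩ := hν.exists_doublingWith
    have hL := h.L1Space_eq_johnNirenbergSpace R τ
    exact ⟨hL, hL ▸ DoublingWith.besovSpace_subset_L1Space R 0,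
      h.johnNirenbergSpace_subset_besovSpace hR hτ hθ,
      DoublingWith.johnNirenbergSpace_anti hR hτ hθ1,
      h.johnNirenbergSpace_one_subset_BVSpace hR hτ,
      fun hb K u hu => h.lipschitzWith_mem_besovSpace hb R hu⟩
  · refine ⟨BinarySequence, inferInstance, inferInstance, inferInstance, BinarySequence.uniform,
      BinarySequence.isDoubling_uniform, BinarySequence.isBounded_univ, ?_⟩
    intro R τ θ hR hτ hθ hθ1
    obtain ⟨C, h⟩ := BinarySequence.isDoubling_uniform.exists_doublingWith
    refine ⟨?_, ?_, fun hlt => ?_⟩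
    · rw [← h.L1Space_eq_johnNirenbergSpace R τ]
      obtain ⟨u, hu, hu'⟩ := BinarySequence.exists_mem_L1Space_notMem_besovSpace
      exact ⟨DoublingWith.besovSpace_subset_L1Space R 0, fun hs => hu' R hR (hs hu)⟩
    -- An intermediate exponent separates the spaces: the example of exponent `θ / 2` is still
    -- Besov, since `θ / 2 > 0`.
    · obtain ⟨u, hu, hu'⟩ := BinarySequence.exists_mem_johnNirenbergSpace_notMem (τ := τ)
        (half_pos hθ) (half_lt_self hθ) hR hτ
      exact ⟨h.johnNirenbergSpace_subset_besovSpace hR hτ hθ, fun hs =>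
        hu' (hs (h.johnNirenbergSpace_subset_besovSpace hR hτ (half_pos hθ) hu))⟩
    · obtain ⟨u, hu, hu'⟩ := BinarySequence.exists_mem_johnNirenbergSpace_notMem (τ := τ)
        hθ hlt hR hτ
      exact ⟨DoublingWith.johnNirenbergSpace_anti hR hτ hθ1, fun hs => hu' (hs hu)⟩
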